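/- Consider a system of $k$ servers under the Most Servers First Quickswap (MSFQ) policy with threshold $\ell$, where $0\le \ell<k-1$. Small jobs need one server each, arrive according to a Poisson process of rate $\lambda_1>0$, and have i.i.d. $\mathrm{Exp}(\mu_1)$ service durations, with $\lambda_1<k\mu_1$; large jobs need all $k$ servers. The policy is non-preemptive, serves small jobs first come first served, and cycles through four phases. Phase 1: serve only large jobs until none remain. Phase 2: serve small jobs, up to $k$ at a time, until the number $n_1$ of small jobs in the system satisfies $n_1<k$. Phase 3: continue in the same way until $n_1\le\ell$. Phase 4: complete the small jobs that are already in service, admitting no other job into service. (In phases 2, 3 and 4 large jobs only wait.) Assume that phase 2 begins with a random number $N_2^S\ge k$ of small jobs, none of which has received service yet, and that $N_2^S$ is independent of the subsequent arrivals of small jobs and of the service durations of the small jobs present or still to arrive. Let $\mathbb{E}[T_3^S]$ be the mean response time (time from arrival to completion) of the small jobs that arrive during phase 3, that is, the expected sum of the response times of the small jobs arriving in one phase 3, divided by the expected number of these jobs; this number has a positive and finite expectation. Define $C_j$ for $j\ge\ell+1$ by \[ C_j=\begin{cases} \dfrac{\lambda_1+(\ell+1)\mu_1}{(\ell+1)\mu_1}\,\mathbf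 1\{\ell+1\le k-1\}, & j=\ell+1,\\[2ex] C_{j-1}\dfrac{\lambda_1(\lambda_1+j\mu_1)}{j\mu_1(\lambda_1+(j-1)\mu_1)}+\dfrac{\lambda_1+j\mu_1}{j\mu_1}\,\mathbf 1\{j\le k-1\}, & \ell+1<j\le k,\\[2ex] \dfrac{\lambda_1}{k\mu_1}\,C_{j-1}, & j>k. \end{cases} \] Then, for every $j\ge\ell+1$, $C_j$ is the expected number of visits of $n_1$ to state $j$ during phase 3 (the visits to $j$ of the M/M/$k$ chain started at $k-1$ and absorbed at $\ell$), and \[ \mathbb{E}[T_3^S]=\frac{\displaystyle\sum_{j=\ell+1}^\infty \frac{C_j}{\lambda_1+\min(k,j)\mu_1}\cdot\frac{k+(j-k+1)^+}{k\mu_1}}{\displaystyle\sum_{j=\ell+1}^\infty \frac{C_j}{\lambda_1+\min(k,j)\mu_1}}, \] where both series converge, the denominator is positive, and $(x)^+=\max(x,0)$. -/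

import Mathlib

open MeasureTheory ProbabilityTheory
open scoped ENNReal

noncomputable section

namespace MSFQ

/-- The phases of a cycle of the MSFQ policy. -/
inductive Phase
  | one | two | three | four
  deriving DecidableEq

/-- The small-job part of the system at an instant just after an event. Small jobs are numbered
in their order of arrival. Jobs `started ≤ i < arrived` wait in the queue, jobs in `inService`
occupy one server each, and the remaining jobs `i < started` have completed. -/
structure Config where
  /-- the current phase -/
  phase : Phase
  /-- number of small jobs that have arrived; also the number of the next one to arrive -/
  arrived : ℕ
  /-- number of small jobs that have entered service -/
  started : ℕ
  /-- the small jobs in service -/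
  inService : Finset ℕ
  /-- `gap i` is what is left of the interarrival time that precedes the arrival of job `i` -/
  gap : ℕ → ℝ
  /-- `work i` is what is left of the service duration of job `i` -/
  work : ℕ → ℝ

/-- The number `n₁` of small jobs in the system. -/
def Config.numJobs (c : Config) : ℕ := c.inService.card + (c.arrived - c.started)

/-- Job `i` is in the system, in service or waiting. -/
def Config.InSystem (c : Config) (i : ℕ) : Prop :=
  i ∈ c.inService ∨ (c.started ≤ i ∧ i < c.arrived)

/-- The time until the next event: the next arrival of a small job, or the first completion of
a small job in service. -/
def Config.holdingTime (c : Config) : ℝ :=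
  (insert (c.gap c.arrived) (c.inService.image c.work)).min' (Finset.insert_nonempty _ _)

/-- The phase after an event that leaves `n` small jobs in the system, `s` of them in service.
Phase 2 ends when `n < k`, phase 3 ends when `n ≤ ℓ`, phase 4 ends when no small job is in service
(several phases may end at the same event). Phase 1, which serves large jobs only, is not
followed further. -/
def nextPhase (k ℓ n s : ℕ) (p : Phase) : Phase :=
  let p₃ := if p = Phase.two ∧ n < k then Phase.three else p
  let p₄ := if p₃ = Phase.three ∧ n ≤ ℓ then Phase.four else p₃
  if p₄ = Phase.four ∧ s = 0 then Phase.one else p₄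

/-- Admit waiting jobs into service, first come first served, as long as there are idle servers.
Only phases 2 and 3 admit small jobs. -/
def Config.admit (k : ℕ) (c : Config) : Config :=
  if c.phase = Phase.two ∨ c.phase = Phase.three then
    let a := min (k - c.inService.card) (c.arrived - c.started)
    { c with
      started := c.started + a
      inService := c.inService ∪ Finset.Ico c.started (c.started + a) }
  else c

/-- Run the system until just after the next event. Each job in service receives service at
unit rate and is never preempted; the policy reacts to the event by updating the phase and then
admitting jobs. -/
def Config.step (k ℓ : ℕ) (c : Config) : Config :=
  let dt := c.holdingTime
  let arrived' := if c.gap c.arrived = dt then c.arrived + 1 else c.arrived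
  let inService' := c.inService.filter (fun i => c.work i ≠ dt)
  Config.admit k
    { phase := nextPhase k ℓ (inService'.card + (arrived' - c.started)) inService'.card c.phase
      arrived := arrived'
      started := c.started
      inService := inService'
      gap := Function.update c.gap c.arrived (c.gap c.arrived - dt)
      work := fun i => if i ∈ c.inService then c.work i - dt else c.work i }

/-- The beginning of phase 2: the small jobs `0, …, N - 1` are present and none of them has
received any service yet. Job `i` has service duration `S i`; for `i ≥ N` it arrives `X i` after
the preceding arrival (after the beginning of phase 2 if `i = N`). -/
def initial (k N : ℕ) (X S : ℕ → ℝ) : Config :=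
  Config.admit k
    { phase := Phase.two, arrived := N, started := 0, inService := ∅, gap := X, work := S }

/-- The system just after the `m`-th event since the beginning of phase 2. -/
def config (k ℓ N : ℕ) (X S : ℕ → ℝ) (m : ℕ) : Config :=
  (Config.step k ℓ)^[m] (initial k N X S)

open Classical in
/-- The response time of job `i`, from its arrival to its completion: the total time
that it is in the system. -/
def responseTime (k ℓ N : ℕ) (X S : ℕ → ℝ) (i : ℕ) : ℝ≥0∞ :=
  ∑' m, if (config k ℓ N X S m).InSystem i then
    ENNReal.ofReal (config k ℓ N X S m).holdingTime else 0

/-- Job `i` arrives during phase 3. -/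
def ArrivesInPhaseThree (k ℓ N : ℕ) (X S : ℕ → ℝ) (i : ℕ) : Prop :=
  ∃ m, (config k ℓ N X S m).phase = Phase.three ∧
    (config k ℓ N X S m).arrived = i ∧ (config k ℓ N X S (m + 1)).arrived = i + 1

open Classical in
/-- The number of small jobs that arrive during phase 3. -/
def numArrivals (k ℓ N : ℕ) (X S : ℕ → ℝ) : ℝ≥0∞ :=
  ∑' i, if ArrivesInPhaseThree k ℓ N X S i then 1 else 0

open Classical in
/-- The sum of the response times of the small jobs that arrive during phase 3. -/
def totalResponse (k ℓ N : ℕ) (X S : ℕ → ℝ) : ℝ≥0∞ :=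
  ∑' i, if ArrivesInPhaseThree k ℓ N X S i then responseTime k ℓ N X S i else 0

/-- The number of visits of `n₁` to state `j` during phase 3. Almost surely every event in
phase 3 changes `n₁` by one, so that the visits to `j` are the indices `m` with `n₁ = j`. -/
def numVisits (k ℓ N : ℕ) (X S : ℕ → ℝ) (j : ℕ) : ℝ≥0∞ :=
  ∑' m, if (config k ℓ N X S m).phase = Phase.three ∧ (config k ℓ N X S m).numJobs = j
    then 1 else 0

variable {Ω : Type*} [MeasurableSpace Ω]

/-- The mean number of small jobs that arrive during phase 3. -/
def meanArrivals (k ℓ : ℕ) (P : Measure Ω) (N : Ω → ℕ) (X S : ℕ → Ω → ℝ) : ℝ≥0∞ :=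
  ∫⁻ ω, numArrivals k ℓ (N ω) (fun i => X i ω) (fun i => S i ω) ∂P

/-- The mean response time `E[T₃^S]` of the small jobs that arrive during phase 3: the mean total
response time of these jobs, per job. -/
def meanResponse (k ℓ : ℕ) (P : Measure Ω) (N : Ω → ℕ) (X S : ℕ → Ω → ℝ) : ℝ≥0∞ :=
  (∫⁻ ω, totalResponse k ℓ (N ω) (fun i => X i ω) (fun i => S i ω) ∂P) / meanArrivals k ℓ P N X S

/-- The mean number of visits of `n₁` to state `j` during phase 3. -/
def meanVisits (k ℓ : ℕ) (P : Measure Ω) (N : Ω → ℕ) (X S : ℕ → Ω → ℝ) (j : ℕ) : ℝ≥0∞ :=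
  ∫⁻ ω, numVisits k ℓ (N ω) (fun i => X i ω) (fun i => S i ω) j ∂P

/-- The recursively defined coefficients `C_j`, `j ≥ ℓ + 1` (and `0` for `j ≤ ℓ`). -/
def coeff (k ℓ : ℕ) (lam mu : ℝ) : ℕ → ℝ
  | 0 => 0
  | i + 1 =>
    let j : ℝ := (i : ℝ) + 1
    if i < ℓ then 0
    else if i = ℓ then
      (lam + j * mu) / (j * mu) * (if i + 1 ≤ k - 1 then 1 else 0)
    else if i + 1 ≤ k then
      coeff k ℓ lam mu i * (lam * (lam + j * mu) / (j * mu * (lam + (j - 1) * mu)))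
        + (lam + j * mu) / (j * mu) * (if i + 1 ≤ k - 1 then 1 else 0)
    else coeff k ℓ lam mu i * (lam / (k * mu))

/-- The weight `C_j / (λ₁ + min(k, j) μ₁)` of state `j`. -/
def weight (k ℓ : ℕ) (lam mu : ℝ) (j : ℕ) : ℝ :=
  coeff k ℓ lam mu j / (lam + (min k j : ℕ) * mu)

/-- The mean response time `(k + (j - k + 1)⁺) / (k μ₁)` of a small job that sees `j` small jobs
on arrival. -/
def responseSeeing (k : ℕ) (mu : ℝ) (j : ℕ) : ℝ :=
  (k + max ((j : ℝ) - k + 1) 0) / (k * mu)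

end MSFQ

end

/-! The holding time is a minimum of independent exponential clocks. By memorylessness, the clock
that rings first, the time at which it rings and the residual clocks are independent, and the
residual clocks are fresh (`lintegral_ringsFirst`, `lintegral_step`). The discrete part of the
configuration is therefore a Markov chain, and the mean of a sum over all events is the Green
operator `green` of that chain applied to the mean of one term (`mean_tsum_iterate`).

Visits: phase three starts at `k - 1` and ends at `ℓ`. Across the cut between `j ≥ ℓ` and `j + 1`,
the downward crossings exceed the upward ones by one if `j + 1 ≤ k - 1`, and are equally many
otherwise. In expectation this is a first-order relation between the visits to `j` and to `j + 1`
(`green_visit_succ`). The `C_j` solve it (`coeff_cut`, `green_visit`). The balance is legitimate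
because phases two and three have finitely many events in expectation, by a Lyapunov function
(`green_serving_ne_top`).

Responses: while a job waits, all `k` servers are busy, so more than `k > ℓ` jobs are present and
phase three cannot end. A job that arrives in phase three is thus never caught in the queue by phase
four. If it sees `j` jobs, it waits for `(j - k + 1)⁺` completions at rate `k μ` and then needs one
service of mean `1 / μ` (`green_holding_arrival`).

The event after a visit to `j` is an arrival with probability `λ / (λ + min(k, j) μ)`, so `λ` times
the weight of `j` is the mean number of arrivals that see `j` (`mean_tsum_arrivalValue`). The
quotient of the two resulting sums loses the factor `λ`. All these values are the same for every
initial number `n ≥ k`, so the law of `N` plays no role (`lintegral_initial`). -/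

namespace MSFQ

/-! ### Races of independent exponential clocks -/

section Clocks

lemma measurable_exponentialPDF (r : ℝ) : Measurable (exponentialPDF r) :=
  (measurable_exponentialPDFReal r).ennreal_ofReal

lemma lintegral_expMeasure (r : ℝ) {f : ℝ → ℝ≥0∞} (hf : Measurable f) :
    ∫⁻ x, f x ∂expMeasure r = ∫⁻ x, exponentialPDF r x * f x := by
  have : expMeasure r = volume.withDensity (exponentialPDF r) := rfl
  rw [this, lintegral_withDensity_eq_lintegral_mul _ (measurable_exponentialPDF r) hf]
  rfl

lemma ae_pos_expMeasure (r : ℝ) : ∀ᵐ x ∂expMeasure r, 0 < x := by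
  have hm : MeasurableSet {x : ℝ | ¬ 0 < x} :=
    (measurableSet_lt measurable_const measurable_id).compl
  rw [ae_iff, ← lintegral_indicator_one hm, lintegral_expMeasure r (measurable_one.indicator hm),
    lintegral_eq_zero_iff
      (by exact (measurable_exponentialPDF r).mul (measurable_one.indicator hm))]
  have h0 : ∀ᵐ x : ℝ, x ≠ 0 := by simp [ae_iff]
  filter_upwards [h0] with x hx
  rcases lt_or_gt_of_ne hx with h | h
  · simp [exponentialPDF_of_neg h]
  · simp [h]

/-- Memorylessness of the exponential distribution. -/
lemma lintegral_expMeasure_shift (r : ℝ) {t : ℝ} (ht : 0 ≤ t) {f : ℝ → ℝ≥0∞}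
    (hf : Measurable f) :
    ∫⁻ x, (if t < x then f (x - t) else 0) ∂expMeasure r
      = ENNReal.ofReal (Real.exp (-(r * t))) * ∫⁻ x, f x ∂expMeasure r := by
  have hm : Measurable fun x => if t < x then f (x - t) else 0 :=
    Measurable.ite (measurableSet_lt measurable_const measurable_id)
      (hf.comp (measurable_id.sub_const t)) measurable_const
  rw [lintegral_expMeasure r hm, lintegral_expMeasure r hf,
    ← lintegral_const_mul _ (by exact (measurable_exponentialPDF r).mul hf),
    ← lintegral_add_right_eq_self _ t]
  -- After the translation by `t` the integrands disagree at the origin, where the density is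
  -- nonzero but the strict inequality fails.
  have h0 : ∀ᵐ x : ℝ, x ≠ 0 := by simp [ae_iff]
  refine lintegral_congr_ae ?_
  filter_upwards [h0] with x hx
  rcases lt_or_gt_of_ne hx with h | h
  · rw [exponentialPDF_of_neg h, if_neg (by linarith)]
    simp
  · rw [exponentialPDF_of_nonneg h.le, exponentialPDF_of_nonneg (by linarith),
      if_pos (by linarith), add_sub_cancel_right, ← mul_assoc,
      ← ENNReal.ofReal_mul (Real.exp_pos _).le]
    congr 2
    rw [mul_left_comm, ← Real.exp_add]
    ring_nf

/-- Tilting an exponential distribution by an exponential factor changes its rate. -/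
lemma lintegral_expMeasure_tilt {r s : ℝ} (hr : 0 < r) (hs : 0 ≤ s) {f : ℝ → ℝ≥0∞}
    (hf : Measurable f) :
    ∫⁻ x, ENNReal.ofReal (Real.exp (-(s * x))) * f x ∂expMeasure r
      = ENNReal.ofReal (r / (r + s)) * ∫⁻ x, f x ∂expMeasure (r + s) := by
  have hm : Measurable fun x : ℝ => ENNReal.ofReal (Real.exp (-(s * x))) := by fun_prop
  rw [lintegral_expMeasure r (by exact hm.mul hf), lintegral_expMeasure _ hf,
    ← lintegral_const_mul _ (by exact (measurable_exponentialPDF _).mul hf)]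
  refine lintegral_congr fun x => ?_
  rcases lt_or_ge x 0 with h | h
  · simp [exponentialPDF_of_neg h]
  · rw [exponentialPDF_of_nonneg h, exponentialPDF_of_nonneg h, ← mul_assoc, ← mul_assoc,
      ← ENNReal.ofReal_mul (by positivity), ← ENNReal.ofReal_mul (by positivity)]
    congr 2
    rw [mul_assoc, ← Real.exp_add]
    have : r + s ≠ 0 := by positivity
    field_simp
    ring_nf

/-- The factor `x` turns the exponential density into `1 / r` times the Gamma density of shape 2 and
rate `r`, which has total mass one. -/
lemma lintegral_ofReal_expMeasure {r : ℝ} (hr : 0 < r) :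
    ∫⁻ x, ENNReal.ofReal x ∂expMeasure r = ENNReal.ofReal (1 / r) := by
  rw [lintegral_expMeasure r ENNReal.measurable_ofReal]
  have h2 : ∀ x : ℝ, exponentialPDF r x * ENNReal.ofReal x
      = ENNReal.ofReal (1 / r) * gammaPDF 2 r x := by
    intro x
    rcases lt_or_ge x 0 with h | h
    · simp [exponentialPDF_of_neg h, gammaPDF_of_neg h]
    · rw [exponentialPDF_of_nonneg h, gammaPDF_of_nonneg h, ← ENNReal.ofReal_mul (by positivity),
        ← ENNReal.ofReal_mul (by positivity)]
      congr 1
      have : (2 : ℝ) - 1 = 1 := by norm_num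
      rw [Real.Gamma_two, this, Real.rpow_one, Real.rpow_two]
      field_simp
  simp_rw [h2]
  have hm : Measurable (gammaPDF 2 r) := (measurable_gammaPDFReal 2 r).ennreal_ofReal
  rw [lintegral_const_mul _ hm, lintegral_gammaPDF_eq_one two_pos hr, mul_one]

variable {ι : Type*} [DecidableEq ι]

/-- Let the clocks in `A` run for a time `t`. -/
def shift (A : Finset ι) (t : ℝ) (x : ι → ℝ) : ι → ℝ := fun i => if i ∈ A then x i - t else x i

lemma measurable_shift (A : Finset ι) {α : Type*} [MeasurableSpace α] {t : α → ℝ} {x : α → ι → ℝ}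
    (ht : Measurable t) (hx : Measurable x) : Measurable fun a => shift A (t a) (x a) := by
  refine measurable_pi_lambda _ fun i => ?_
  unfold shift
  split_ifs
  · exact ((measurable_pi_apply i).comp hx).sub ht
  · exact (measurable_pi_apply i).comp hx

/-- The clock `e` is the first one in `A` to ring, and the only one at that time. -/
def RingsFirst (A : Finset ι) (e : ι) (x : ι → ℝ) : Prop := ∀ b ∈ A.erase e, x e < x b

lemma measurableSet_ringsFirst (A : Finset ι) (e : ι) : MeasurableSet {x | RingsFirst A e x} := by
  have : {x : ι → ℝ | RingsFirst A e x} = ⋂ b ∈ A.erase e, {x | x e < x b} := by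
    ext; simp [RingsFirst]
  rw [this]
  exact Finset.measurableSet_biInter _ fun b _ =>
    measurableSet_lt (measurable_pi_apply e) (measurable_pi_apply b)

lemma measurable_update_prod (e : ι) :
    Measurable fun p : (ι → ℝ) × ℝ => Function.update p.1 e p.2 := by
  refine measurable_pi_lambda _ fun i => ?_
  by_cases h : i = e
  · subst h; simpa using measurable_snd
  · simp only [Function.update_of_ne h]
    fun_prop

/-- Resampling a coordinate of a product measure. -/
lemma lintegral_infinitePi_update (ν : ι → Measure ℝ) [∀ i, IsProbabilityMeasure (ν i)] (e : ι)
    {F : (ι → ℝ) → ℝ≥0∞} (hF : Measurable F) :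
    ∫⁻ x, F x ∂Measure.infinitePi ν
      = ∫⁻ x, ∫⁻ t, F (Function.update x e t) ∂ν e ∂Measure.infinitePi ν := by
  have hu := measurable_update_prod e
  have key : ((Measure.infinitePi ν).prod (ν e)).map
      (fun p : (ι → ℝ) × ℝ => Function.update p.1 e p.2) = Measure.infinitePi ν := by
    refine Measure.eq_infinitePi _ fun s T hT => ?_
    rw [Measure.map_apply hu (.pi s.countable_toSet fun i _ => hT i)]
    have : (fun p : (ι → ℝ) × ℝ => Function.update p.1 e p.2) ⁻¹' ((s : Set ι).pi T)
        = ((s.erase e : Finset ι) : Set ι).pi T ×ˢ (if e ∈ s then T e else Set.univ) := by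
      ext ⟨x, t⟩
      simp only [Set.mem_preimage, Set.mem_pi, Set.mem_prod, Finset.mem_coe, Finset.mem_erase]
      constructor
      · refine fun h => ⟨fun i hi => ?_, ?_⟩
        · simpa [hi.1] using h i hi.2
        · split_ifs with he
          · simpa using h e he
          · trivial
      · rintro ⟨h1, h2⟩ i hi
        by_cases hie : i = e
        · subst hie; simpa [hi] using h2
        · simpa [hie] using h1 i ⟨hie, hi⟩
    rw [this, Measure.prod_prod, Measure.infinitePi_pi _ fun i _ => hT i]
    split_ifs with he
    · exact Finset.prod_erase_mul s (fun i => ν i (T i)) he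
    · simp [Finset.erase_eq_of_notMem he]
  conv_lhs => rw [← key]
  rw [lintegral_map hF hu, lintegral_prod _ (by exact (hF.comp hu).aemeasurable)]

variable {r : ι → ℝ} (hr : ∀ i, 0 < r i)
include hr

/-- Clocks that have not rung by time `t` are as good as new. -/
lemma lintegral_shift (B : Finset ι) {t : ℝ} (ht : 0 ≤ t) {F : (ι → ℝ) → ℝ≥0∞}
    (hF : Measurable F) :
    ∫⁻ x, {x | ∀ b ∈ B, t < x b}.indicator (fun x => F (shift B t x)) x
        ∂Measure.infinitePi (fun i => expMeasure (r i))
      = ENNReal.ofReal (Real.exp (-((∑ b ∈ B, r b) * t)))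
        * ∫⁻ x, F x ∂Measure.infinitePi (fun i => expMeasure (r i)) := by
  have : ∀ i, IsProbabilityMeasure (expMeasure (r i)) := fun i =>
    isProbabilityMeasure_expMeasure (hr i)
  have hmset : ∀ B : Finset ι, MeasurableSet {x : ι → ℝ | ∀ b ∈ B, t < x b} := fun B => by
    have : {x : ι → ℝ | ∀ b ∈ B, t < x b} = ⋂ b ∈ B, {x | t < x b} := by ext; simp
    rw [this]
    exact Finset.measurableSet_biInter _ fun b _ =>
      measurableSet_lt measurable_const (measurable_pi_apply b)
  have hmeas : ∀ B : Finset ι, Measurable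
      ({x : ι → ℝ | ∀ b ∈ B, t < x b}.indicator fun x => F (shift B t x)) := fun B =>
    (hF.comp (measurable_shift B measurable_const measurable_id)).indicator (hmset B)
  induction B using Finset.induction_on with
  | empty =>
    simp only [Finset.notMem_empty, false_imp_iff, implies_true, Set.ofPred_true,
      Set.indicator_univ, Finset.sum_empty, zero_mul, neg_zero, Real.exp_zero, ENNReal.ofReal_one,
      one_mul]
    rfl
  | insert e B he ih =>
    -- Resampling coordinate `e` on both sides exposes a one-dimensional integral, to which
    -- memorylessness applies with the other coordinates frozen.
    rw [lintegral_infinitePi_update _ e (hmeas _), Finset.sum_insert he, add_mul, neg_add,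
      Real.exp_add, ENNReal.ofReal_mul (Real.exp_pos _).le, mul_assoc, ← ih,
      lintegral_infinitePi_update _ e (hmeas B), ← lintegral_const_mul]
    rotate_left
    · exact ((hmeas B).comp (measurable_update_prod e)).lintegral_prod_right'
        (ν := expMeasure (r e))
    refine lintegral_congr fun x => ?_
    have hb : ∀ u, ∀ b ∈ B, Function.update x e u b = x b := fun u b hbB =>
      Function.update_of_ne (by rintro rfl; exact he hbB) _ _
    have hs : ∀ u, shift B t (Function.update x e u) = Function.update (shift B t x) e u := by
      intro u
      ext i
      by_cases hi : i = e
      · subst hi; simp [shift, he]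
      · simp [shift, hi]
    have hs' : ∀ u, shift (insert e B) t (Function.update x e u)
        = Function.update (shift B t x) e (u - t) := by
      intro u
      ext i
      by_cases hi : i = e
      · subst hi; simp [shift]
      · simp [shift, hi]
    by_cases hx : ∀ b ∈ B, t < x b
    · have h1 : ∀ u, Function.update x e u ∈ {x : ι → ℝ | ∀ b ∈ B, t < x b} := fun u b hbB => by
        rw [hb u b hbB]; exact hx b hbB
      have h2 : ∀ u, {x : ι → ℝ | ∀ b ∈ insert e B, t < x b}.indicator
          (fun x => F (shift (insert e B) t x)) (Function.update x e u)
          = if t < u then F (Function.update (shift B t x) e (u - t)) else 0 := by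
        intro u
        rw [Set.indicator_apply, hs']
        congr 1
        simp only [Set.mem_ofPred_eq, Finset.forall_mem_insert, Function.update_self, eq_iff_iff,
          and_iff_left_iff_imp]
        exact fun _ => h1 u
      simp_rw [h2]
      rw [lintegral_expMeasure_shift (r e) ht
        (f := fun u => F (Function.update (shift B t x) e u)) (hF.comp (measurable_update _))]
      congr 1
      refine lintegral_congr fun u => ?_
      rw [Set.indicator_of_mem (h1 u), hs]
    · have h1 : ∀ u, Function.update x e u ∉ {x : ι → ℝ | ∀ b ∈ B, t < x b} := fun u h =>
        hx fun b hbB => by rw [← hb u b hbB]; exact h b hbB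
      have h2 : ∀ u, Function.update x e u ∉ {x : ι → ℝ | ∀ b ∈ insert e B, t < x b} :=
        fun u h => h1 u fun b hbB => h b (Finset.mem_insert_of_mem hbB)
      simp only [Set.indicator_of_notMem (h1 _), Set.indicator_of_notMem (h2 _), lintegral_zero,
        mul_zero]

/-- The race of exponential clocks: the identity of the first clock to ring, its time and the
residual clocks are independent. -/
lemma lintegral_ringsFirst {A : Finset ι} {e : ι} (he : e ∈ A) {φ : ℝ → ℝ≥0∞} (hφ : Measurable φ)
    {F : (ι → ℝ) → ℝ≥0∞} (hF : Measurable F) (hFe : ∀ x t, F (Function.update x e t) = F x) :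
    ∫⁻ x, {x | RingsFirst A e x}.indicator (fun x => φ (x e) * F (shift A (x e) x)) x
        ∂Measure.infinitePi (fun i => expMeasure (r i))
      = ENNReal.ofReal (r e / ∑ b ∈ A, r b) * (∫⁻ t, φ t ∂expMeasure (∑ b ∈ A, r b))
        * ∫⁻ x, F x ∂Measure.infinitePi (fun i => expMeasure (r i)) := by
  have : ∀ i, IsProbabilityMeasure (expMeasure (r i)) := fun i =>
    isProbabilityMeasure_expMeasure (hr i)
  have hm : Measurable ({x : ι → ℝ | RingsFirst A e x}.indicator
      fun x => φ (x e) * F (shift A (x e) x)) :=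
    ((hφ.comp (measurable_pi_apply e)).mul
      (hF.comp (measurable_shift A (measurable_pi_apply e) measurable_id))).indicator
      (measurableSet_ringsFirst A e)
  have hu : ∀ x t, {x : ι → ℝ | RingsFirst A e x}.indicator
      (fun x => φ (x e) * F (shift A (x e) x)) (Function.update x e t)
      = φ t * {x : ι → ℝ | ∀ b ∈ A.erase e, t < x b}.indicator
        (fun x => F (shift (A.erase e) t x)) x := by
    intro x t
    have h1 : (Function.update x e t ∈ {x : ι → ℝ | RingsFirst A e x})
        = (x ∈ {x : ι → ℝ | ∀ b ∈ A.erase e, t < x b}) := by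
      simp only [RingsFirst, Set.mem_ofPred_eq, eq_iff_iff]
      refine forall₂_congr fun b hb => ?_
      simp [Finset.ne_of_mem_erase hb]
    -- The two arguments differ at most in coordinate `e`, which `F` ignores; setting that
    -- coordinate to `0` on both sides makes them equal.
    have h2 : F (shift A t (Function.update x e t)) = F (shift (A.erase e) t x) := by
      rw [← hFe _ 0, ← hFe (shift (A.erase e) t x) 0]
      congr 1
      ext i
      by_cases hi : i = e
      · subst hi; simp
      · simp [shift, hi]
    by_cases hx : x ∈ {x : ι → ℝ | ∀ b ∈ A.erase e, t < x b}
    · rw [Set.indicator_of_mem hx, Set.indicator_of_mem (h1 ▸ hx), Function.update_self, h2]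
    · rw [Set.indicator_of_notMem hx, Set.indicator_of_notMem (h1 ▸ hx), mul_zero]
  -- Condition on the value `t` of clock `e`. The others survive `t` with probability `exp (-(R - r
  -- e) t)`, where `R` is the total rate, and are then fresh. This factor tilts the law of `t` from
  -- rate `r e` to rate `R`, at the price of `r e / R`.
  rw [lintegral_infinitePi_update _ e hm, lintegral_lintegral_swap
    (by exact (hm.comp (measurable_update_prod e)).aemeasurable)]
  simp_rw [hu]
  have h3 : ∀ᵐ t ∂expMeasure (r e), ∫⁻ x, φ t * {x : ι → ℝ | ∀ b ∈ A.erase e, t < x b}.indicator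
        (fun x => F (shift (A.erase e) t x)) x ∂Measure.infinitePi (fun i => expMeasure (r i))
      = ENNReal.ofReal (Real.exp (-((∑ b ∈ A.erase e, r b) * t))) * φ t
        * ∫⁻ x, F x ∂Measure.infinitePi (fun i => expMeasure (r i)) := by
    filter_upwards [ae_pos_expMeasure (r e)] with t ht
    rw [lintegral_const_mul, lintegral_shift hr _ ht.le hF]
    · ring
    · refine (hF.comp (measurable_shift _ measurable_const measurable_id)).indicator ?_
      simp only [Set.ofPred_forall]
      exact Finset.measurableSet_biInter _ fun b _ =>
        measurableSet_lt measurable_const (measurable_pi_apply b)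
  rw [lintegral_congr_ae h3, lintegral_mul_const _ (by fun_prop),
    lintegral_expMeasure_tilt (hr e) (Finset.sum_nonneg fun b _ => (hr b).le) hφ,
    Finset.add_sum_erase _ _ he]

/-- Almost surely, one of finitely many exponential clocks rings first. -/
lemma ae_ringsFirst {A : Finset ι} (hA : A.Nonempty) :
    ∀ᵐ x ∂Measure.infinitePi (fun i => expMeasure (r i)), ∃ e ∈ A, RingsFirst A e x := by
  have : ∀ i, IsProbabilityMeasure (expMeasure (r i)) := fun i =>
    isProbabilityMeasure_expMeasure (hr i)
  have hR : 0 < ∑ b ∈ A, r b := Finset.sum_pos (fun b _ => hr b) hA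
  have := isProbabilityMeasure_expMeasure hR
  set M := Measure.infinitePi (fun i => expMeasure (r i))
  -- The race with constant test functions. These events are disjoint and their probabilities add up
  -- to one, so ties are negligible.
  have h1 : ∀ e ∈ A, M {x | RingsFirst A e x} = ENNReal.ofReal (r e / ∑ b ∈ A, r b) := by
    intro e he
    have := lintegral_ringsFirst hr he (φ := fun _ => 1) measurable_const
      (F := fun _ => 1) measurable_const (fun _ _ => rfl)
    rw [← lintegral_indicator_one (measurableSet_ringsFirst A e)]
    simp only [mul_one, lintegral_const, measure_univ] at this
    exact this
  have hd : Set.PairwiseDisjoint (A : Set ι) fun e => {x : ι → ℝ | RingsFirst A e x} := by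
    intro a ha b hb hab
    refine Set.disjoint_left.2 fun x hx hx' => ?_
    exact lt_asymm (hx b (Finset.mem_erase.2 ⟨hab.symm, hb⟩)) (hx' a (Finset.mem_erase.2 ⟨hab, ha⟩))
  have h2 : M (⋃ e ∈ A, {x | RingsFirst A e x}) = 1 := by
    rw [measure_biUnion_finset hd fun e _ => measurableSet_ringsFirst A e, Finset.sum_congr rfl h1,
      ← ENNReal.ofReal_sum_of_nonneg fun i _ => div_nonneg (hr i).le hR.le, ← Finset.sum_div,
      div_self hR.ne', ENNReal.ofReal_one]
  have h3 := (prob_compl_eq_zero_iff (μ := M) (Finset.measurableSet_biUnion A fun e _ =>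
    measurableSet_ringsFirst A e)).2 h2
  filter_upwards [compl_mem_ae_iff.2 h3] with x hx
  simpa using hx

end Clocks

/-! ### The embedded Markov chain -/

section Markov

/-- The residual times: `inl i` is the clock of the arrival of job `i`, and `inr i` the clock of
its completion. -/
abbrev Clocks := ℕ ⊕ ℕ → ℝ

/-- The configuration `c` with its residual times replaced. -/
def Config.withClocks (c : Config) (x : Clocks) : Config :=
  { c with gap := fun i => x (Sum.inl i), work := fun i => x (Sum.inr i) }

@[simp] lemma Config.withClocks_arrived (c : Config) (x : Clocks) :
    (c.withClocks x).arrived = c.arrived := rfl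

lemma Config.exists_withClocks (c : Config) : ∃ x, c.withClocks x = c :=
  ⟨Sum.elim c.gap c.work, rfl⟩

lemma Config.withClocks_admit (k : ℕ) (c : Config) (x : Clocks) :
    Config.admit k (c.withClocks x) = (Config.admit k c).withClocks x := by
  unfold Config.admit
  by_cases h : c.phase = Phase.two ∨ c.phase = Phase.three
  · rw [if_pos h, if_pos (by exact h)]
    rfl
  · rw [if_neg h, if_neg (by exact h)]

/-- The clocks that are running. -/
def Config.active (c : Config) : Finset (ℕ ⊕ ℕ) :=
  insert (Sum.inl c.arrived) (c.inService.map ⟨Sum.inr, Sum.inr_injective⟩)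

lemma Config.mem_active {c : Config} {e : ℕ ⊕ ℕ} :
    e ∈ c.active ↔ e = Sum.inl c.arrived ∨ ∃ i ∈ c.inService, e = Sum.inr i := by
  simp [active, eq_comm]

lemma Config.active_nonempty (c : Config) : c.active.Nonempty := Finset.insert_nonempty _ _

/-- The configuration after the clocks in `E` have rung, with the other clocks unchanged. -/
def Config.after (k ℓ : ℕ) (c : Config) (E : Finset (ℕ ⊕ ℕ)) : Config :=
  let arrived' := if Sum.inl c.arrived ∈ E then c.arrived + 1 else c.arrived
  let inService' := c.inService.filter (fun i => Sum.inr i ∉ E)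
  Config.admit k
    { c with
      phase := nextPhase k ℓ (inService'.card + (arrived' - c.started)) inService'.card c.phase
      arrived := arrived'
      inService := inService' }

lemma Config.holdingTime_withClocks (c : Config) (x : Clocks) :
    (c.withClocks x).holdingTime = c.active.inf' c.active_nonempty x := by
  have : insert ((c.withClocks x).gap (c.withClocks x).arrived)
      ((c.withClocks x).inService.image (c.withClocks x).work) = c.active.image x := by
    ext t
    simp [active, withClocks]
  unfold holdingTime
  simp only [this, Finset.min', Finset.inf'_image]
  rfl

/-- The clocks that ring at the next event. -/
noncomputable def Config.ringing (c : Config) (x : Clocks) : Finset (ℕ ⊕ ℕ) :=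
  c.active.filter fun e => x e = (c.withClocks x).holdingTime

/-- Separates the discrete part of a step, which depends on the clocks only through the set that
rings, from the running down of the active clocks. Since this set may have several elements, the
identity holds for every `x`, ties included. -/
lemma Config.step_withClocks (k ℓ : ℕ) (c : Config) (x : Clocks) :
    (c.withClocks x).step k ℓ
      = (c.after k ℓ (c.ringing x)).withClocks
          (shift c.active (c.withClocks x).holdingTime x) := by
  set t := (c.withClocks x).holdingTime with ht
  have h1 : Sum.inl c.arrived ∈ c.ringing x ↔ x (Sum.inl c.arrived) = t := by
    simp [ringing, active, ht]
  have h2 : c.inService.filter (fun i => x (Sum.inr i) ≠ t)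
      = c.inService.filter (fun i => Sum.inr i ∉ c.ringing x) := by
    refine Finset.filter_congr fun i hi => ?_
    simp [ringing, active, hi, ← ht]
  unfold step after
  rw [← Config.withClocks_admit]
  simp only [← ht]
  have h3 : Function.update (fun i => x (Sum.inl i)) c.arrived (x (Sum.inl c.arrived) - t)
      = fun i => shift c.active t x (Sum.inl i) := by
    funext i
    by_cases hi : i = c.arrived
    · subst hi; simp [shift, active]
    · simp [shift, active, hi]
  have h4 : (fun i => if i ∈ c.inService then x (Sum.inr i) - t else x (Sum.inr i))
      = fun i => shift c.active t x (Sum.inr i) := by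
    funext i
    simp [shift, active]
  simp only [withClocks, h1, h3, ← h4, ← h2]
  congr!

lemma Config.holdingTime_of_ringsFirst {c : Config} {e : ℕ ⊕ ℕ} (he : e ∈ c.active) {x : Clocks}
    (hx : RingsFirst c.active e x) : (c.withClocks x).holdingTime = x e := by
  rw [holdingTime_withClocks]
  refine le_antisymm (Finset.inf'_le _ he) (Finset.le_inf' _ _ fun b hb => ?_)
  by_cases hbe : b = e
  · rw [hbe]
  · exact (hx b (Finset.mem_erase.2 ⟨hbe, hb⟩)).le

lemma Config.ringing_of_ringsFirst {c : Config} {e : ℕ ⊕ ℕ} (he : e ∈ c.active) {x : Clocks}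
    (hx : RingsFirst c.active e x) : c.ringing x = {e} := by
  ext b
  rw [ringing, Finset.mem_filter, holdingTime_of_ringsFirst he hx, Finset.mem_singleton]
  constructor
  · rintro ⟨hb, h⟩
    by_contra hbe
    exact (hx b (Finset.mem_erase.2 ⟨hbe, hb⟩)).ne' h
  · rintro rfl
    exact ⟨he, rfl⟩

lemma Config.measurable_holdingTime (c : Config) :
    Measurable fun x => (c.withClocks x).holdingTime := by
  simp_rw [holdingTime_withClocks]
  refine measurable_of_Iio fun t => ?_
  have : (fun x : Clocks => c.active.inf' c.active_nonempty x) ⁻¹' Set.Iio t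
      = ⋃ e ∈ c.active, {x | x e < t} := by
    ext x
    simp [Finset.inf'_lt_iff]
  rw [this]
  exact Finset.measurableSet_biUnion _ fun e _ =>
    measurableSet_lt (measurable_pi_apply e) measurable_const

/-- The clocks that matter for the future. -/
def Config.Relevant (c : Config) : ℕ ⊕ ℕ → Prop
  | Sum.inl i => c.arrived ≤ i
  | Sum.inr i => i ∈ c.inService ∨ c.started ≤ i

/-- Jobs are numbered in the order of their arrival and served first come first served. -/
structure Config.Ordered (c : Config) : Prop where
  lt_started : ∀ i ∈ c.inService, i < c.started
  started_le : c.started ≤ c.arrived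

lemma Config.after_arrived (k ℓ : ℕ) (c : Config) (E : Finset (ℕ ⊕ ℕ)) :
    (c.after k ℓ E).arrived = if Sum.inl c.arrived ∈ E then c.arrived + 1 else c.arrived := by
  simp only [after, Config.admit]
  split_ifs <;> rfl

lemma Config.started_le_after (k ℓ : ℕ) (c : Config) (E : Finset (ℕ ⊕ ℕ)) :
    c.started ≤ (c.after k ℓ E).started := by
  simp only [after, Config.admit]
  split_ifs <;> simp

lemma Config.mem_after_inService {k ℓ : ℕ} {c : Config} {E : Finset (ℕ ⊕ ℕ)} {i : ℕ}
    (hi : i ∈ (c.after k ℓ E).inService) :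
    (i ∈ c.inService ∧ Sum.inr i ∉ E) ∨ (c.started ≤ i ∧ i < (c.after k ℓ E).started) := by
  revert hi
  simp only [after, Config.admit]
  split_ifs <;> simp +contextual

lemma Config.Ordered.after {c : Config} (h : c.Ordered) (k ℓ : ℕ) (E : Finset (ℕ ⊕ ℕ)) :
    (c.after k ℓ E).Ordered where
  lt_started i hi := by
    rcases mem_after_inService hi with h1 | h1
    · exact (h.lt_started i h1.1).trans_le (started_le_after k ℓ c E)
    · exact h1.2
  started_le := by
    have := h.started_le
    simp only [Config.after, Config.admit]
    split_ifs <;> simp <;> omega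

lemma Config.ordered_withClocks {c : Config} {x : Clocks} : (c.withClocks x).Ordered ↔ c.Ordered :=
  ⟨fun h => ⟨h.1, h.2⟩, fun h => ⟨h.1, h.2⟩⟩

lemma Config.Ordered.step {c : Config} (h : c.Ordered) (k ℓ : ℕ) : (c.step k ℓ).Ordered := by
  obtain ⟨x, hx⟩ := c.exists_withClocks
  rw [← hx, step_withClocks, ordered_withClocks]
  exact h.after k ℓ _

lemma Config.Relevant.of_after {k ℓ : ℕ} {c : Config} {E : Finset (ℕ ⊕ ℕ)} {e : ℕ ⊕ ℕ}
    (he : (c.after k ℓ E).Relevant e) : c.Relevant e := by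
  rcases e with i | i
  · simp only [Relevant, after_arrived] at he ⊢
    split_ifs at he <;> omega
  · rcases he with he | he
    · rcases mem_after_inService he with h | h
      · exact Or.inl h.1
      · exact Or.inr h.1
    · exact Or.inr ((started_le_after k ℓ c E).trans he)

/-- A clock that has rung belongs to a job already arrived or already completed, and numbers are
never reused. This supplies the hypothesis of `lintegral_ringsFirst` that the future ignores the
clock `e`. -/
lemma Config.Ordered.not_relevant_after {c : Config} (h : c.Ordered) {k ℓ : ℕ} {e : ℕ ⊕ ℕ}
    (he : e ∈ c.active) : ¬ (c.after k ℓ {e}).Relevant e := by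
  rcases mem_active.1 he with rfl | ⟨i, hi, rfl⟩
  · simp [Relevant, after_arrived]
  · rintro (h1 | h1)
    · rcases mem_after_inService h1 with h2 | h2
      · simp at h2
      · exact absurd (h.lt_started i hi) (not_lt.2 h2.1)
    · exact absurd (h.lt_started i hi) (not_lt.2 ((started_le_after k ℓ c _).trans h1))

lemma Config.relevant_of_mem_active {c : Config} {e : ℕ ⊕ ℕ} (he : e ∈ c.active) :
    c.Relevant e := by
  rcases mem_active.1 he with rfl | ⟨i, hi, rfl⟩
  · exact le_rfl
  · exact Or.inl hi

/-- `F` depends measurably on the residual times of the clocks that matter, and on no others. -/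
structure Observable (F : Config → ℝ≥0∞) : Prop where
  measurable : ∀ c : Config, Measurable fun x => F (c.withClocks x)
  congr : ∀ (c : Config) (x y : Clocks), (∀ e, c.Relevant e → x e = y e) →
    F (c.withClocks x) = F (c.withClocks y)

/-- Only the clocks carry a σ-algebra here. The discrete part after a step is indexed by the finite
set of ringing clocks, hence by a countable type, and measurability is checked for each index
separately. -/
lemma Observable.measurable_comp {F : Config → ℝ≥0∞} (hF : Observable F) {ι α : Type*} [Countable ι]
    [MeasurableSpace α] (c : ι → Config) {j : α → ι} (hj : ∀ i, MeasurableSet (j ⁻¹' {i}))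
    {x : α → Clocks} (hx : Measurable x) : Measurable fun a => F ((c (j a)).withClocks (x a)) := by
  let _ : MeasurableSpace ι := ⊤
  have hj' : Measurable j := measurable_to_countable' hj
  have : Measurable fun p : ι × Clocks => F ((c p.1).withClocks p.2) :=
    measurable_from_prod_countable_right fun i => hF.measurable (c i)
  exact this.comp (hj'.prodMk hx)

lemma Config.measurableSet_ringing (c : Config) (E : Finset (ℕ ⊕ ℕ)) :
    MeasurableSet (c.ringing ⁻¹' {E}) := by
  have : c.ringing ⁻¹' {E} = {_x : Clocks | E ⊆ c.active} ∩
      ⋂ e ∈ c.active, {x | x e = (c.withClocks x).holdingTime ↔ e ∈ E} := by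
    ext x
    simp only [Set.mem_preimage, Set.mem_singleton_iff, Set.mem_inter_iff, Set.mem_iInter,
      Set.mem_ofPred_eq, ringing]
    constructor
    · rintro rfl
      exact ⟨Finset.filter_subset _ _, fun e he => by simp [he]⟩
    · rintro ⟨h1, h2⟩
      ext e
      rw [Finset.mem_filter]
      exact ⟨fun h => (h2 e h.1).1 h.2, fun h => ⟨h1 h, (h2 e (h1 h)).2 h⟩⟩
  rw [this]
  refine (MeasurableSet.const _).inter (Finset.measurableSet_biInter _ fun e _ => ?_)
  have hm : MeasurableSet {x : Clocks | x e = (c.withClocks x).holdingTime} :=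
    measurableSet_eq_fun (measurable_pi_apply e) c.measurable_holdingTime
  by_cases he : e ∈ E
  · simpa [he] using hm
  · simp only [he, iff_false]
    exact hm.compl

lemma Config.holdingTime_congr {c : Config} {x y : Clocks} (h : ∀ e, c.Relevant e → x e = y e) :
    (c.withClocks x).holdingTime = (c.withClocks y).holdingTime := by
  rw [holdingTime_withClocks, holdingTime_withClocks]
  exact Finset.inf'_congr _ rfl fun e he => h e (relevant_of_mem_active he)

lemma Observable.comp_step {F : Config → ℝ≥0∞} (hF : Observable F) (k ℓ : ℕ) :
    Observable fun c => F (c.step k ℓ) where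
  measurable c := by
    simp_rw [Config.step_withClocks]
    exact hF.measurable_comp (c.after k ℓ) c.measurableSet_ringing
      (measurable_shift _ c.measurable_holdingTime measurable_id)
  congr c x y h := by
    have h1 := Config.holdingTime_congr h
    have h2 : c.ringing x = c.ringing y := by
      refine Finset.filter_congr fun e he => ?_
      rw [h1, h e (Config.relevant_of_mem_active he)]
    rw [Config.step_withClocks, Config.step_withClocks, h1, h2]
    refine hF.congr _ _ _ fun e he => ?_
    simp only [shift, h e he.of_after]

lemma Observable.iterate {F : Config → ℝ≥0∞} (hF : Observable F) (k ℓ m : ℕ) :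
    Observable fun c => F ((Config.step k ℓ)^[m] c) := by
  induction m generalizing F with
  | zero => exact hF
  | succ m ih =>
    simp_rw [Function.iterate_succ_apply']
    exact ih (hF.comp_step k ℓ)

lemma Observable.tsum {F : ℕ → Config → ℝ≥0∞} (hF : ∀ m, Observable (F m)) :
    Observable fun c => ∑' m, F m c where
  measurable c := Measurable.tsum fun m => (hF m).measurable c
  congr c x y h := tsum_congr fun m => (hF m).congr c x y h

lemma observable_of_withClocks {F : Config → ℝ≥0∞}
    (h : ∀ (c : Config) x, F (c.withClocks x) = F c) : Observable F where
  measurable c := by simp_rw [h]; exact measurable_const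
  congr c x y _ := by rw [h, h]

lemma Observable.mul {F G : Config → ℝ≥0∞} (hF : Observable F) (hG : Observable G) :
    Observable fun c => F c * G c where
  measurable c := (hF.measurable c).mul (hG.measurable c)
  congr c x y h := by rw [hF.congr c x y h, hG.congr c x y h]

lemma observable_holdingTime : Observable fun c => ENNReal.ofReal c.holdingTime where
  measurable c := c.measurable_holdingTime.ennreal_ofReal
  congr c x y h := by rw [Config.holdingTime_congr h]

/-- The rates of the clocks. -/
def rate (lam mu : ℝ) : ℕ ⊕ ℕ → ℝ := Sum.elim (fun _ => lam) (fun _ => mu)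

/-- The joint law of independent exponential clocks. -/
noncomputable def clockLaw (lam mu : ℝ) : Measure Clocks :=
  Measure.infinitePi fun e => expMeasure (rate lam mu e)

/-- The mean of `F` when all clocks are fresh. -/
noncomputable def mean (lam mu : ℝ) (F : Config → ℝ≥0∞) (c : Config) : ℝ≥0∞ :=
  ∫⁻ x, F (c.withClocks x) ∂clockLaw lam mu

/-- The total rate of the running clocks. -/
noncomputable def Config.totalRate (lam mu : ℝ) (c : Config) : ℝ := lam + c.inService.card * mu

/-- The transition operator of the embedded Markov chain. -/
noncomputable def trans (k ℓ : ℕ) (lam mu : ℝ) (f : Config → ℝ≥0∞) (c : Config) : ℝ≥0∞ :=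
  ∑ e ∈ c.active, ENNReal.ofReal (rate lam mu e / c.totalRate lam mu) * f (c.after k ℓ {e})

lemma Config.sum_active (c : Config) {R : Type*} [AddCommMonoid R] (g : ℕ ⊕ ℕ → R) :
    ∑ e ∈ c.active, g e = g (Sum.inl c.arrived) + ∑ i ∈ c.inService, g (Sum.inr i) := by
  rw [active, Finset.sum_insert (by simp), Finset.sum_map]
  rfl

lemma Config.sum_rate (lam mu : ℝ) (c : Config) :
    ∑ e ∈ c.active, rate lam mu e = c.totalRate lam mu := by
  simp [sum_active, rate, totalRate]

variable {lam mu : ℝ} (hlam : 0 < lam) (hmu : 0 < mu)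
include hlam hmu

lemma rate_pos (e : ℕ ⊕ ℕ) : 0 < rate lam mu e := by
  rcases e with i | i
  · exact hlam
  · exact hmu

lemma isProbabilityMeasure_clockLaw : IsProbabilityMeasure (clockLaw lam mu) := by
  have := fun e => isProbabilityMeasure_expMeasure (rate_pos hlam hmu e)
  unfold clockLaw
  infer_instance

lemma Config.totalRate_pos (c : Config) : 0 < c.totalRate lam mu := by
  unfold totalRate; positivity

lemma sum_transition (c : Config) :
    ∑ e ∈ c.active, ENNReal.ofReal (rate lam mu e / c.totalRate lam mu) = 1 := by
  rw [← ENNReal.ofReal_sum_of_nonneg fun e _ =>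
    div_nonneg (rate_pos hlam hmu e).le (c.totalRate_pos hlam hmu).le, ← Finset.sum_div,
    c.sum_rate, div_self (c.totalRate_pos hlam hmu).ne', ENNReal.ofReal_one]

/-- The Markov property at the first event: the next configuration, its residual times and the
holding time are independent, and the residual times are fresh. -/
lemma lintegral_step (k ℓ : ℕ) {φ : ℝ → ℝ≥0∞} (hφ : Measurable φ) {F : Config → ℝ≥0∞}
    (hF : Observable F) {c : Config} (hc : c.Ordered) :
    ∫⁻ x, φ (c.withClocks x).holdingTime * F ((c.withClocks x).step k ℓ) ∂clockLaw lam mu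
      = (∫⁻ t, φ t ∂expMeasure (c.totalRate lam mu)) * trans k ℓ lam mu (mean lam mu F) c := by
  have hr := rate_pos hlam hmu
  have hG : ∀ e, Measurable fun x => F ((c.after k ℓ {e}).withClocks x) := fun e => hF.measurable _
  -- Decompose according to the first clock to ring, which is almost surely unique; exactly one
  -- summand is then active.
  have h1 : ∀ᵐ x ∂clockLaw lam mu,
      φ (c.withClocks x).holdingTime * F ((c.withClocks x).step k ℓ)
        = ∑ e ∈ c.active, {x | RingsFirst c.active e x}.indicator
          (fun x => φ (x e) * F ((c.after k ℓ {e}).withClocks (shift c.active (x e) x))) x := by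
    filter_upwards [ae_ringsFirst hr c.active_nonempty] with x ⟨e, he, hx⟩
    rw [Finset.sum_eq_single_of_mem e he, Set.indicator_of_mem (by exact hx),
      Config.step_withClocks,
      Config.holdingTime_of_ringsFirst he hx, Config.ringing_of_ringsFirst he hx]
    intro b hb hbe
    refine Set.indicator_of_notMem (fun h => ?_) _
    exact lt_asymm (hx b (Finset.mem_erase.2 ⟨hbe, hb⟩)) (h e (Finset.mem_erase.2 ⟨hbe.symm, he⟩))
  rw [lintegral_congr_ae h1, lintegral_finsetSum, trans, Finset.mul_sum]
  · refine Finset.sum_congr rfl fun e he => ?_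
    have h2 := lintegral_ringsFirst hr he hφ (hG e) fun x t => hF.congr _ _ _ fun b hb => by
      refine Function.update_of_ne (fun h => ?_) _ _
      exact hc.not_relevant_after he (h ▸ hb)
    rw [Config.sum_rate] at h2
    rw [clockLaw, h2, mean, clockLaw]
    ring
  · intro e _
    exact ((hφ.comp (measurable_pi_apply e)).mul ((hG e).comp
      (measurable_shift _ (measurable_pi_apply e) measurable_id))).indicator
      (measurableSet_ringsFirst _ _)

lemma mean_step (k ℓ : ℕ) {F : Config → ℝ≥0∞} (hF : Observable F) {c : Config} (hc : c.Ordered) :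
    mean lam mu (fun c => F (c.step k ℓ)) c = trans k ℓ lam mu (mean lam mu F) c := by
  have := isProbabilityMeasure_expMeasure (c.totalRate_pos hlam hmu)
  have h := lintegral_step hlam hmu k ℓ (φ := fun _ => 1) measurable_const hF hc
  simp only [one_mul, lintegral_const, measure_univ] at h
  exact h

lemma mean_holdingTime {c : Config} (hc : c.Ordered) :
    mean lam mu (fun c => ENNReal.ofReal c.holdingTime) c
      = ENNReal.ofReal (1 / c.totalRate lam mu) := by
  have := isProbabilityMeasure_clockLaw hlam hmu
  -- With `F = 1` the transition is irrelevant, so `0 0` are placeholders for the policy parameters.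
  have h := lintegral_step hlam hmu 0 0 ENNReal.measurable_ofReal
    (observable_of_withClocks (F := fun _ => 1) fun _ _ => rfl) hc
  simp only [mul_one, trans, mean, lintegral_const, measure_univ] at h
  rw [mean, h, sum_transition hlam hmu, mul_one,
    lintegral_ofReal_expMeasure (c.totalRate_pos hlam hmu)]

lemma mean_of_withClocks {F : Config → ℝ≥0∞} (h : ∀ (c : Config) x, F (c.withClocks x) = F c)
    (c : Config) : mean lam mu F c = F c := by
  have := isProbabilityMeasure_clockLaw hlam hmu
  simp [mean, h]

omit hlam hmu in
lemma trans_congr {k ℓ : ℕ} {f g : Config → ℝ≥0∞} {c : Config}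
    (h : ∀ e ∈ c.active, f (c.after k ℓ {e}) = g (c.after k ℓ {e})) :
    trans k ℓ lam mu f c = trans k ℓ lam mu g c :=
  Finset.sum_congr rfl fun e he => by rw [h e he]

/-- The residual clocks are fresh after the first event, so the Markov property can be applied again
from the next configuration. -/
lemma mean_iterate (k ℓ m : ℕ) {F : Config → ℝ≥0∞} (hF : Observable F) {c : Config}
    (hc : c.Ordered) :
    mean lam mu (fun c => F ((Config.step k ℓ)^[m] c)) c
      = (trans k ℓ lam mu)^[m] (mean lam mu F) c := by
  induction m generalizing c with
  | zero => rfl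
  | succ m ih =>
    rw [Function.iterate_succ_apply']
    refine (mean_step hlam hmu k ℓ (hF.iterate k ℓ m) hc).trans ?_
    exact trans_congr fun e _ => ih (hc.after k ℓ _)

end Markov

/-! ### Potential theory of the transition operator -/

section Operator

variable {k ℓ : ℕ} {lam mu : ℝ}

lemma trans_add (f g : Config → ℝ≥0∞) :
    trans k ℓ lam mu (f + g) = trans k ℓ lam mu f + trans k ℓ lam mu g := by
  ext c
  simp [trans, mul_add, Finset.sum_add_distrib]

lemma trans_const_mul (a : ℝ≥0∞) (f : Config → ℝ≥0∞) :
    trans k ℓ lam mu (fun c => a * f c) = fun c => a * trans k ℓ lam mu f c := by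
  ext c
  simp only [trans, Finset.mul_sum]
  exact Finset.sum_congr rfl fun e _ => by ring

lemma trans_tsum (f : ℕ → Config → ℝ≥0∞) :
    trans k ℓ lam mu (fun c => ∑' j, f j c) = fun c => ∑' j, trans k ℓ lam mu (f j) c := by
  ext c
  simp only [trans, ← ENNReal.tsum_mul_left]
  exact (Summable.tsum_finsetSum fun _ _ => ENNReal.summable).symm

lemma iterate_trans_add (m : ℕ) (f g : Config → ℝ≥0∞) :
    (trans k ℓ lam mu)^[m] (f + g) = (trans k ℓ lam mu)^[m] f + (trans k ℓ lam mu)^[m] g := by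
  induction m generalizing f g with
  | zero => rfl
  | succ m ih => simp only [Function.iterate_succ_apply, trans_add, ih]

lemma iterate_trans_const_mul (m : ℕ) (a : ℝ≥0∞) (f : Config → ℝ≥0∞) :
    (trans k ℓ lam mu)^[m] (fun c => a * f c) = fun c => a * (trans k ℓ lam mu)^[m] f c := by
  induction m generalizing f with
  | zero => rfl
  | succ m ih => simp only [Function.iterate_succ_apply, trans_const_mul, ih]

lemma iterate_trans_tsum (m : ℕ) (f : ℕ → Config → ℝ≥0∞) :
    (trans k ℓ lam mu)^[m] (fun c => ∑' j, f j c)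
      = fun c => ∑' j, (trans k ℓ lam mu)^[m] (f j) c := by
  induction m generalizing f with
  | zero => rfl
  | succ m ih => simp only [Function.iterate_succ_apply, trans_tsum, ih]

/-- `Q` is closed under the transitions of the embedded chain. -/
def Closed (k ℓ : ℕ) (Q : Config → Prop) : Prop :=
  ∀ c, Q c → ∀ e ∈ c.active, Q (c.after k ℓ {e})

variable {Q : Config → Prop}

lemma Closed.iterate_mono (hQ : Closed k ℓ Q) {f g : Config → ℝ≥0∞} (h : ∀ c, Q c → f c ≤ g c)
    (m : ℕ) : ∀ c, Q c → (trans k ℓ lam mu)^[m] f c ≤ (trans k ℓ lam mu)^[m] g c := by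
  induction m generalizing f g with
  | zero => exact h
  | succ m ih =>
    simp only [Function.iterate_succ_apply]
    exact ih fun c hc => Finset.sum_le_sum fun e he => by gcongr; exact h _ (hQ c hc e he)

lemma Closed.iterate_congr (hQ : Closed k ℓ Q) {f g : Config → ℝ≥0∞} (h : ∀ c, Q c → f c = g c)
    (m : ℕ) {c : Config} (hc : Q c) :
    (trans k ℓ lam mu)^[m] f c = (trans k ℓ lam mu)^[m] g c :=
  le_antisymm (hQ.iterate_mono (fun c hc => (h c hc).le) m c hc)
    (hQ.iterate_mono (fun c hc => (h c hc).ge) m c hc)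

/-- The Green operator of the embedded chain. -/
noncomputable def green (k ℓ : ℕ) (lam mu : ℝ) (f : Config → ℝ≥0∞) (c : Config) : ℝ≥0∞ :=
  ∑' m, (trans k ℓ lam mu)^[m] f c

lemma green_const_mul (a : ℝ≥0∞) (f : Config → ℝ≥0∞) (c : Config) :
    green k ℓ lam mu (fun c => a * f c) c = a * green k ℓ lam mu f c := by
  simp only [green, iterate_trans_const_mul, ENNReal.tsum_mul_left]

lemma green_tsum (f : ℕ → Config → ℝ≥0∞) (c : Config) :
    green k ℓ lam mu (fun c => ∑' j, f j c) c = ∑' j, green k ℓ lam mu (f j) c := by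
  simp only [green, iterate_trans_tsum]
  exact ENNReal.tsum_comm

lemma Closed.green_congr (hQ : Closed k ℓ Q) {f g : Config → ℝ≥0∞} (h : ∀ c, Q c → f c = g c)
    {c : Config} (hc : Q c) : green k ℓ lam mu f c = green k ℓ lam mu g c :=
  tsum_congr fun m => hQ.iterate_congr h m hc

/-- Minimality of the potential among supersolutions: iterating the inequality bounds each partial
sum plus the remainder `T^M h` by `h`, where `T` is the transition operator. -/
lemma Closed.green_le (hQ : Closed k ℓ Q) {g h : Config → ℝ≥0∞}
    (hgh : ∀ c, Q c → g c + trans k ℓ lam mu h c ≤ h c) {c : Config} (hc : Q c) :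
    green k ℓ lam mu g c ≤ h c := by
  refine ENNReal.tsum_le_of_sum_range_le fun M => ?_
  suffices H : ∑ m ∈ Finset.range M, (trans k ℓ lam mu)^[m] g c + (trans k ℓ lam mu)^[M] h c ≤ h c
    from le_self_add.trans H
  induction M with
  | zero => simp
  | succ M ih =>
    refine le_trans ?_ ih
    rw [Finset.sum_range_succ, add_assoc, Function.iterate_succ_apply]
    gcongr
    have := hQ.iterate_mono (lam := lam) (mu := mu) (f := g + trans k ℓ lam mu h) hgh M c hc
    rwa [iterate_trans_add] at this

/-- The telescoping of `d - u = s - T s`, with `T` the transition operator. All terms are kept on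
the side where they are added, because subtraction in `ℝ≥0∞` is truncated and the two potentials
might be infinite. -/
lemma Closed.green_add_eq (hQ : Closed k ℓ Q) {d u s : Config → ℝ≥0∞}
    (h : ∀ c, Q c → d c + trans k ℓ lam mu s c = u c + s c) {c : Config} (hc : Q c)
    (hs : Filter.Tendsto (fun m => (trans k ℓ lam mu)^[m] s c) Filter.atTop (nhds 0)) :
    green k ℓ lam mu d c = green k ℓ lam mu u c + s c := by
  have key : ∀ M, ∑ m ∈ Finset.range M, (trans k ℓ lam mu)^[m] d c + (trans k ℓ lam mu)^[M] s c
      = ∑ m ∈ Finset.range M, (trans k ℓ lam mu)^[m] u c + s c := by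
    intro M
    induction M with
    | zero => simp
    | succ M ih =>
      have := hQ.iterate_congr (lam := lam) (mu := mu) (f := d + trans k ℓ lam mu s) (g := u + s)
        h M hc
      rw [iterate_trans_add, iterate_trans_add, Pi.add_apply, Pi.add_apply] at this
      rw [Finset.sum_range_succ, add_assoc, Function.iterate_succ_apply, this,
        Finset.sum_range_succ, add_right_comm, ← ih]
      ring
  have h1 := (ENNReal.summable (f := fun m => (trans k ℓ lam mu)^[m] d c)).hasSum.tendsto_sum_nat
    |>.add hs
  have h2 := (ENNReal.summable (f := fun m => (trans k ℓ lam mu)^[m] u c)).hasSum.tendsto_sum_nat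
    |>.add (tendsto_const_nhds (x := s c))
  simp only [key, add_zero] at h1
  exact tendsto_nhds_unique h1 h2

lemma tendsto_of_green_ne_top {g : Config → ℝ≥0∞} {c : Config} (h : green k ℓ lam mu g c ≠ ∞) :
    Filter.Tendsto (fun m => (trans k ℓ lam mu)^[m] g c) Filter.atTop (nhds 0) :=
  ENNReal.tendsto_atTop_zero_of_tsum_ne_top h

lemma Closed.tendsto_of_le_mul (hQ : Closed k ℓ Q) {f g : Config → ℝ≥0∞} {K : ℝ≥0∞} (hK : K ≠ ∞)
    (h : ∀ c, Q c → f c ≤ K * g c) {c : Config} (hc : Q c) (hg : green k ℓ lam mu g c ≠ ∞) :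
    Filter.Tendsto (fun m => (trans k ℓ lam mu)^[m] f c) Filter.atTop (nhds 0) := by
  have h1 := ENNReal.Tendsto.const_mul (tendsto_of_green_ne_top hg) (Or.inr hK)
  rw [mul_zero] at h1
  refine tendsto_of_tendsto_of_tendsto_of_le_of_le tendsto_const_nhds h1 (fun _ => zero_le) ?_
  intro m
  have := hQ.iterate_mono (lam := lam) (mu := mu) h m c hc
  rwa [iterate_trans_const_mul] at this

/-- A solution of the Poisson equation need not be the potential in general. Here the supersolution
bound makes the potential of `g` finite at `c`, so the iterates of `g` tend to zero there, and `f ≤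
K * g` forces the same for the remainder. -/
lemma Closed.green_eq (hQ : Closed k ℓ Q) {f g : Config → ℝ≥0∞}
    (h : ∀ c, Q c → g c + trans k ℓ lam mu f c = f c) {K : ℝ≥0∞} (hK : K ≠ ∞)
    (hfg : ∀ c, Q c → f c ≤ K * g c) {c : Config} (hc : Q c) (hf : f c ≠ ∞) :
    green k ℓ lam mu g c = f c := by
  have h1 : green k ℓ lam mu g c ≠ ∞ := ((hQ.green_le (fun c hc => (h c hc).le) hc).trans_lt
    hf.lt_top).ne
  have h0 : ∀ m, (trans k ℓ lam mu)^[m] (fun _ => 0) c = 0 := fun m => by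
    have := congrFun (iterate_trans_const_mul (k := k) (ℓ := ℓ) (lam := lam) (mu := mu) m 0 g) c
    simpa using this
  have := hQ.green_add_eq (d := g) (u := fun _ => 0) (s := f) (fun c hc => by rw [zero_add, h c hc])
    hc (hQ.tendsto_of_le_mul hK hfg hc h1)
  simpa [green, h0] using this

end Operator

/-! ### Transitions of the policy and its invariants -/

section Transitions

variable {k ℓ : ℕ} {c : Config}

lemma Config.admit_phase (k : ℕ) (c : Config) : (Config.admit k c).phase = c.phase := by
  unfold Config.admit
  split_ifs <;> rfl

lemma Config.card_admit (hc : ∀ i ∈ c.inService, i < c.started)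
    (hp : c.phase = Phase.two ∨ c.phase = Phase.three) :
    (Config.admit k c).inService.card
      = c.inService.card + min (k - c.inService.card) (c.arrived - c.started) := by
  unfold Config.admit
  rw [if_pos hp]
  simp only
  rw [Finset.card_union_of_disjoint, Nat.card_Ico, Nat.add_sub_cancel_left]
  rw [Finset.disjoint_left]
  intro i hi hi'
  have := hc i hi
  rw [Finset.mem_Ico] at hi'
  omega

lemma Config.numJobs_admit (hc : ∀ i ∈ c.inService, i < c.started) :
    (Config.admit k c).numJobs = c.numJobs := by
  by_cases hp : c.phase = Phase.two ∨ c.phase = Phase.three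
  · have h := card_admit (k := k) hc hp
    unfold numJobs
    rw [h]
    unfold Config.admit
    rw [if_pos hp]
    simp only
    omega
  · unfold Config.admit
    rw [if_neg hp]

lemma Config.after_arrival (k ℓ : ℕ) (c : Config) :
    c.after k ℓ {Sum.inl c.arrived} = Config.admit k
      { c with
        phase := nextPhase k ℓ (c.inService.card + (c.arrived + 1 - c.started)) c.inService.card
          c.phase
        arrived := c.arrived + 1 } := by
  simp [after]

lemma Config.after_completion (k ℓ : ℕ) (c : Config) (b : ℕ) :
    c.after k ℓ {Sum.inr b} = Config.admit k
      { c with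
        phase := nextPhase k ℓ ((c.inService.erase b).card + (c.arrived - c.started))
          (c.inService.erase b).card c.phase
        inService := c.inService.erase b } := by
  have : c.inService.filter (fun i => i ≠ b) = c.inService.erase b := by
    ext; simp [and_comm]
  simp [after, this]

lemma Config.Ordered.numJobs_arrival (hc : c.Ordered) :
    (c.after k ℓ {Sum.inl c.arrived}).numJobs = c.numJobs + 1 := by
  rw [after_arrival, numJobs_admit (by exact hc.lt_started)]
  have := hc.started_le
  simp only [numJobs]
  omega

lemma Config.Ordered.numJobs_completion (hc : c.Ordered) {b : ℕ} (hb : b ∈ c.inService) :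
    (c.after k ℓ {Sum.inr b}).numJobs + 1 = c.numJobs := by
  rw [after_completion, numJobs_admit
    (by exact fun i hi => hc.lt_started i (Finset.mem_of_mem_erase hi))]
  have := Finset.card_erase_add_one hb
  simp only [numJobs]
  omega

/-- Phases two and three. -/
def Config.Serving (c : Config) : Prop := c.phase = Phase.two ∨ c.phase = Phase.three

lemma Config.after_phase_arrival (hc : c.Ordered) :
    (c.after k ℓ {Sum.inl c.arrived}).phase
      = nextPhase k ℓ (c.numJobs + 1) c.inService.card c.phase := by
  rw [after_arrival, admit_phase]
  have := hc.started_le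
  simp only [numJobs]
  congr 1
  omega

lemma Config.after_phase_completion {b : ℕ} (hb : b ∈ c.inService) :
    (c.after k ℓ {Sum.inr b}).phase
      = nextPhase k ℓ (c.numJobs - 1) (c.inService.card - 1) c.phase := by
  rw [after_completion, admit_phase]
  have := Finset.card_erase_add_one hb
  simp only [numJobs]
  congr 1 <;> omega

/-- In phase two at least `k` jobs are present before an event, so at least `k - 1 > ℓ` remain after
it: phase three is never skipped. -/
lemma nextPhase_two {n s : ℕ} (hn : k ≤ n + 1) (hk : ℓ + 1 < k) :
    nextPhase k ℓ n s Phase.two = if k ≤ n then Phase.two else Phase.three := by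
  unfold nextPhase
  by_cases h : k ≤ n
  · simp [h, not_lt.2 h]
  · have h1 : n < k := by omega
    have h2 : ¬ n ≤ ℓ := by omega
    simp [h1, h2]

lemma nextPhase_three_of_lt {n s : ℕ} (hn : ℓ < n) :
    nextPhase k ℓ n s Phase.three = Phase.three := by
  simp [nextPhase, hn]

lemma not_serving_nextPhase_three {n s : ℕ} (hn : n ≤ ℓ) :
    nextPhase k ℓ n s Phase.three ≠ Phase.two ∧ nextPhase k ℓ n s Phase.three ≠ Phase.three := by
  by_cases hs : s = 0 <;> simp [nextPhase, hn, hs]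

lemma not_serving_nextPhase {n s : ℕ} {p : Phase} (h2 : p ≠ Phase.two) (h3 : p ≠ Phase.three) :
    nextPhase k ℓ n s p ≠ Phase.two ∧ nextPhase k ℓ n s p ≠ Phase.three := by
  cases p
  · simp [nextPhase]
  · exact absurd rfl h2
  · exact absurd rfl h3
  · by_cases hs : s = 0 <;> simp [nextPhase, hs]

/-- The configurations that the policy can reach. -/
structure Config.Valid (k ℓ : ℕ) (c : Config) : Prop extends c.Ordered where
  card_le : c.inService.card ≤ k
  full : c.Serving → c.inService.card = min k c.numJobs
  two : c.phase = Phase.two → k ≤ c.numJobs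
  three : c.phase = Phase.three → ℓ < c.numJobs

lemma Config.Valid.phase_arrival (hk : ℓ + 1 < k) (hc : c.Valid k ℓ) (hs : c.Serving) :
    (c.after k ℓ {Sum.inl c.arrived}).phase = c.phase := by
  rw [after_phase_arrival hc.toOrdered]
  rcases hs with h | h
  · have := hc.two h
    rw [h, nextPhase_two (by omega) hk, if_pos (by omega)]
  · have := hc.three h
    rw [h, nextPhase_three_of_lt (by omega)]

lemma Config.Valid.phase_completion_two (hk : ℓ + 1 < k) (hc : c.Valid k ℓ)
    (h : c.phase = Phase.two) {b : ℕ} (hb : b ∈ c.inService) :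
    (c.after k ℓ {Sum.inr b}).phase = if k + 1 ≤ c.numJobs then Phase.two else Phase.three := by
  have := hc.two h
  rw [after_phase_completion hb, h, nextPhase_two (by omega) hk]
  congr 1
  rw [eq_iff_iff]
  omega

lemma Config.phase_completion_three (h : c.phase = Phase.three) (hn : ℓ + 1 < c.numJobs)
    {b : ℕ} (hb : b ∈ c.inService) : (c.after k ℓ {Sum.inr b}).phase = Phase.three := by
  rw [after_phase_completion hb, h, nextPhase_three_of_lt (by omega)]

lemma Config.not_serving_completion_three (h : c.phase = Phase.three) (hn : c.numJobs ≤ ℓ + 1)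
    {b : ℕ} (hb : b ∈ c.inService) : ¬ (c.after k ℓ {Sum.inr b}).Serving := by
  rw [Serving, after_phase_completion hb, h, not_or]
  exact not_serving_nextPhase_three (by omega)

lemma Config.Ordered.not_serving_after (hc : c.Ordered) (h : ¬ c.Serving) {e : ℕ ⊕ ℕ}
    (he : e ∈ c.active) : ¬ (c.after k ℓ {e}).Serving := by
  rw [Serving, not_or] at h ⊢
  rcases mem_active.1 he with rfl | ⟨b, hb, rfl⟩
  · rw [after_phase_arrival hc]
    exact not_serving_nextPhase h.1 h.2
  · rw [after_phase_completion hb]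
    exact not_serving_nextPhase h.1 h.2

/-- Admission takes the smaller of the idle servers and the waiting jobs, which leaves either every
server busy or no job waiting. -/
lemma Config.Ordered.card_after (hc : c.Ordered) (hck : c.inService.card ≤ k) {e : ℕ ⊕ ℕ} :
    (c.after k ℓ {e}).inService.card ≤ k ∧
    ((c.after k ℓ {e}).Serving →
      (c.after k ℓ {e}).inService.card = min k (c.after k ℓ {e}).numJobs) := by
  obtain ⟨c', h0, hst, hsub⟩ : ∃ c', c.after k ℓ {e} = Config.admit k c' ∧ c'.started = c.started ∧
      c'.inService ⊆ c.inService := ⟨_, rfl, rfl, Finset.filter_subset _ _⟩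
  have h1 : ∀ i ∈ c'.inService, i < c'.started := fun i hi => hst ▸ hc.lt_started i (hsub hi)
  have h2 : c'.inService.card ≤ k := (Finset.card_le_card hsub).trans hck
  have h3 : (Config.admit k c').Serving →
      (Config.admit k c').inService.card = min k (Config.admit k c').numJobs := by
    intro hs
    rw [Serving, admit_phase] at hs
    rw [numJobs_admit h1, card_admit h1 hs, numJobs]
    omega
  rw [h0]
  refine ⟨?_, h3⟩
  by_cases hs : c'.phase = Phase.two ∨ c'.phase = Phase.three
  · rw [card_admit h1 hs]
    omega
  · unfold Config.admit
    rwa [if_neg hs]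

lemma closed_valid (hk : ℓ + 1 < k) : Closed k ℓ (Config.Valid k ℓ) := by
  intro c hc e he
  have h1 := hc.toOrdered.card_after (k := k) (ℓ := ℓ) hc.card_le (e := e)
  refine ⟨hc.toOrdered.after k ℓ _, h1.1, h1.2, fun h => ?_, fun h => ?_⟩
  · by_cases hs : c.Serving
    · rcases Config.mem_active.1 he with rfl | ⟨b, hb, rfl⟩
      · rw [hc.phase_arrival hk hs] at h
        have := hc.two h
        rw [hc.toOrdered.numJobs_arrival]
        omega
      · have h3 := hc.toOrdered.numJobs_completion (k := k) (ℓ := ℓ) hb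
        rcases hs with h2 | h2
        · rw [hc.phase_completion_two hk h2 hb] at h
          split_ifs at h
          omega
        · by_cases hn : ℓ + 1 < c.numJobs
          · rw [Config.phase_completion_three h2 hn hb] at h
            cases h
          · exact absurd (Or.inl h) (Config.not_serving_completion_three h2 (by omega) hb)
    · exact absurd (Or.inl h) (hc.toOrdered.not_serving_after hs he)
  · by_cases hs : c.Serving
    · rcases Config.mem_active.1 he with rfl | ⟨b, hb, rfl⟩
      · rw [hc.phase_arrival hk hs] at h
        have := hc.three h
        rw [hc.toOrdered.numJobs_arrival]
        omega
      · have h3 := hc.toOrdered.numJobs_completion (k := k) (ℓ := ℓ) hb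
        rcases hs with h2 | h2
        · have := hc.two h2
          omega
        · by_cases hn : ℓ + 1 < c.numJobs
          · omega
          · exact absurd (Or.inr h) (Config.not_serving_completion_three h2 (by omega) hb)
    · exact absurd (Or.inr h) (hc.toOrdered.not_serving_after hs he)

/-- A transition of a busy system, for a function that does not distinguish the completions. -/
lemma trans_eq {lam mu : ℝ} (hlam : 0 < lam) (hmu : 0 < mu) {f : Config → ℝ≥0∞} {u v : ℝ≥0∞}
    (hu : f (c.after k ℓ {Sum.inl c.arrived}) = u)
    (hv : ∀ b ∈ c.inService, f (c.after k ℓ {Sum.inr b}) = v) :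
    trans k ℓ lam mu f c = ENNReal.ofReal (lam / c.totalRate lam mu) * u
      + ENNReal.ofReal (c.inService.card * mu / c.totalRate lam mu) * v := by
  have := c.totalRate_pos hlam hmu
  rw [trans, Config.sum_active, hu, Finset.sum_congr rfl fun b hb => by rw [hv b hb],
    ← Finset.sum_mul]
  simp only [rate, Sum.elim_inl, Sum.elim_inr, Finset.sum_const, nsmul_eq_mul]
  rw [mul_div_assoc, ENNReal.ofReal_mul (Nat.cast_nonneg _), ENNReal.ofReal_natCast]

end Transitions

/-! ### Expected visits in phase three -/

section Visits

variable {k ℓ : ℕ} {lam mu : ℝ} {c : Config}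

/-- The drift condition for a function of `n` with increments `β ^ (k - 1 - n)`, multiplied by the
total rate. From `k` on, the truncated exponents vanish and `ε` is chosen to give equality. Below
`k` the departure rate may be smaller than `λ`, so the increments must grow steeply downwards; `β =
(2 λ + k μ) / μ` suffices since `ε ≤ 1`. -/
lemma lyapunov_drift (hlam : 0 < lam) (hmu : 0 < mu) (hstable : lam < k * mu) {n : ℕ} (hn : 1 ≤ n) :
    (k * mu - lam) / (k * mu + lam) * (lam + (min k n : ℕ) * mu)
        + lam * ((2 * lam + k * mu) / mu) ^ (k - 1 - n)
      ≤ (min k n : ℕ) * mu * ((2 * lam + k * mu) / mu) ^ (k - 1 - (n - 1)) := by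
  have hkmu : 0 < k * mu := hlam.trans hstable
  rcases le_or_gt k n with h | h
  · have h1 : k - 1 - n = 0 := by omega
    have h2 : k - 1 - (n - 1) = 0 := by omega
    rw [h1, h2, min_eq_left h, pow_zero, add_comm lam, div_mul_cancel₀ _ (by positivity)]
    linarith
  · have h1 : k - 1 - (n - 1) = (k - 1 - n) + 1 := by omega
    have h2 : (k * mu - lam) / (k * mu + lam) ≤ 1 := by
      rw [div_le_one (by positivity)]; linarith
    have hn' : (1 : ℝ) ≤ n := by exact_mod_cast hn
    have hβ : 1 ≤ (2 * lam + k * mu) / mu := by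
      rw [le_div_iff₀ hmu]
      have : (1 : ℝ) ≤ k := by exact_mod_cast hn.trans h.le
      nlinarith
    have hp : 1 ≤ ((2 * lam + k * mu) / mu) ^ (k - 1 - n) := one_le_pow₀ hβ
    rw [h1, min_eq_right h.le, pow_succ]
    set p := ((2 * lam + k * mu) / mu) ^ (k - 1 - n)
    have h3 : n * mu * (p * ((2 * lam + k * mu) / mu)) = n * (2 * lam + k * mu) * p := by
      field_simp
    rw [h3]
    have h4 : (k * mu - lam) / (k * mu + lam) * (lam + n * mu) ≤ 1 * (lam + n * mu) := by
      gcongr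
    have h5 : (n : ℝ) ≤ k := by exact_mod_cast h.le
    have h6 : n * mu ≤ n * (k * mu) := by
      have : (1 : ℝ) ≤ k := hn'.trans h5
      have : mu ≤ k * mu := by nlinarith
      gcongr
    have h7 : lam ≤ n * lam := by nlinarith
    have h8 : (lam + n * mu) ≤ (lam + n * mu) * p := by
      have : 0 < lam + n * mu := by positivity
      nlinarith
    nlinarith

lemma Config.Valid.totalRate_eq (hc : c.Valid k ℓ) (hs : c.Serving) :
    c.totalRate lam mu = lam + (min k c.numJobs : ℕ) * mu := by
  rw [totalRate, hc.full hs]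

lemma Config.Valid.numJobs_pos (hk : ℓ + 1 < k) (hc : c.Valid k ℓ) (hs : c.Serving) :
    1 ≤ c.numJobs := by
  rcases hs with h | h
  · have := hc.two h
    omega
  · have := hc.three h
    omega

lemma ofReal_sum_transition (hlam : 0 < lam) (hmu : 0 < mu) (c : Config) :
    ENNReal.ofReal (lam / c.totalRate lam mu)
      + ENNReal.ofReal (c.inService.card * mu / c.totalRate lam mu) = 1 := by
  have h := c.totalRate_pos hlam hmu
  rw [← ENNReal.ofReal_add (by positivity) (by positivity), ← add_div,
    ← ENNReal.ofReal_one]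
  congr 1
  exact div_self h.ne'

open Classical in
/-- Phases two and three end almost surely: the expected number of events in them is finite. -/
lemma green_serving_ne_top (hk : ℓ + 1 < k) (hlam : 0 < lam) (hmu : 0 < mu)
    (hstable : lam < k * mu) (hc : c.Valid k ℓ) :
    green k ℓ lam mu (fun c => if c.Serving then 1 else 0) c ≠ ∞ := by
  set β := (2 * lam + k * mu) / mu with hβ
  set ε := (k * mu - lam) / (k * mu + lam) with hε
  have hkmu : 0 < k * mu := hlam.trans hstable
  have hβ0 : 0 < β := by positivity
  have hε0 : 0 < ε := div_pos (by linarith) (by positivity)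
  -- By truncated subtraction the increments are constantly `1` from `k - 1` on, so `H` is
  -- eventually linear.
  set H : ℕ → ℝ := fun n => ∑ i ∈ Finset.range n, β ^ (k - 1 - i) with hH
  have hH0 : ∀ n, 0 ≤ H n := fun n => Finset.sum_nonneg fun i _ => by positivity
  set h : Config → ℝ≥0∞ := fun c => if c.Serving then ENNReal.ofReal (H c.numJobs) else 0 with hh
  have hle : ∀ c, h c ≤ ENNReal.ofReal (H c.numJobs) := fun c => by
    simp only [hh]; split_ifs <;> simp
  have key : ∀ c : Config, c.Valid k ℓ →
      ENNReal.ofReal ε * (if c.Serving then 1 else 0) + trans k ℓ lam mu h c ≤ h c := by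
    intro c hc
    by_cases hs : c.Serving
    · have hn := hc.numJobs_pos hk hs
      have hR := c.totalRate_pos hlam hmu
      -- Leaving phases two and three only lowers `h`, so the drift may be estimated with `H` of the
      -- number of jobs in every case.
      have h1 : trans k ℓ lam mu h c ≤ ENNReal.ofReal (lam / c.totalRate lam mu)
          * ENNReal.ofReal (H (c.numJobs + 1)) + ENNReal.ofReal (c.inService.card * mu
          / c.totalRate lam mu) * ENNReal.ofReal (H (c.numJobs - 1)) := by
        rw [← trans_eq (k := k) (ℓ := ℓ) hlam hmu (c := c)
          (f := fun c => ENNReal.ofReal (H c.numJobs))]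
        · exact Finset.sum_le_sum fun e _ => by gcongr; exact hle _
        · rw [hc.toOrdered.numJobs_arrival]
        · intro b hb
          rw [← hc.toOrdered.numJobs_completion hb, Nat.add_sub_cancel]
      refine (add_le_add_right h1 _).trans ?_
      simp only [hh, if_pos hs, mul_one]
      rw [← ENNReal.ofReal_mul (by positivity), ← ENNReal.ofReal_mul (by positivity),
        ← ENNReal.ofReal_add (mul_nonneg (by positivity) (hH0 _))
          (mul_nonneg (by positivity) (hH0 _)),
        ← ENNReal.ofReal_add hε0.le (add_nonneg (mul_nonneg (by positivity) (hH0 _))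
          (mul_nonneg (by positivity) (hH0 _)))]
      refine ENNReal.ofReal_le_ofReal ?_
      obtain ⟨n, hn'⟩ : ∃ n, c.numJobs = n + 1 := ⟨c.numJobs - 1, by omega⟩
      have h2 := lyapunov_drift hlam hmu hstable hn
      rw [← hc.full hs, ← hβ, ← hε] at h2
      change ε * c.totalRate lam mu + _ ≤ _ at h2
      rw [hn', Nat.add_sub_cancel] at h2 ⊢
      have h3 : H (n + 1) = H n + β ^ (k - 1 - n) := Finset.sum_range_succ _ _
      have h4 : H (n + 1 + 1) = H (n + 1) + β ^ (k - 1 - (n + 1)) := Finset.sum_range_succ _ _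
      have h5 : c.totalRate lam mu = lam + c.inService.card * mu := rfl
      rw [div_mul_eq_mul_div, div_mul_eq_mul_div, ← add_div, ← le_sub_iff_add_le', div_le_iff₀ hR,
        h4, h3]
      have h6 : c.totalRate lam mu * (H n + β ^ (k - 1 - n))
        = (lam + c.inService.card * mu) * (H n + β ^ (k - 1 - n)) := by rw [h5]
      linarith
    · have h1 : trans k ℓ lam mu h c = 0 := Finset.sum_eq_zero fun e he => by
        simp only [hh, if_neg (hc.toOrdered.not_serving_after hs he), mul_zero]
      rw [if_neg hs, h1]
      simp
  have h1 := (closed_valid hk).green_le key hc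
  rw [green_const_mul] at h1
  intro htop
  rw [htop, ENNReal.mul_top (by simpa using hε0)] at h1
  exact absurd ((top_le_iff.1 h1).symm.trans_le (hle c)) (by simp)

open Classical in
/-- The indicator of the configurations in phase three with `j` jobs. -/
noncomputable def visit (j : ℕ) (c : Config) : ℝ≥0∞ :=
  if c.phase = Phase.three ∧ c.numJobs = j then 1 else 0

/-- The cut equation between `j` and `j + 1`. -/
lemma green_visit_succ (hk : ℓ + 1 < k) (hlam : 0 < lam) (hmu : 0 < mu)
    (hstable : lam < k * mu) (hc : c.Valid k ℓ) (h2 : c.phase = Phase.two) {j : ℕ} (hj : ℓ ≤ j) :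
    ENNReal.ofReal ((min k (j + 1) : ℕ) * mu / (lam + (min k (j + 1) : ℕ) * mu))
        * green k ℓ lam mu (visit (j + 1)) c
      = ENNReal.ofReal (lam / (lam + (min k j : ℕ) * mu)) * green k ℓ lam mu (visit j) c
        + if j + 1 < k then 1 else 0 := by
  classical
  -- The indicator of being above the cut. Phase two counts as above exactly when the entry state `k
  -- - 1` of phase three is above, so the change of phase is never a crossing. The drift of `s` is
  -- then the probability of an upward crossing minus that of a downward one.
  set s : Config → ℝ≥0∞ := fun c =>
    if (c.phase = Phase.two ∧ j + 1 < k) ∨ (c.phase = Phase.three ∧ j + 1 ≤ c.numJobs) then 1 else 0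
    with hs
  have hs0 : ∀ c : Config, ¬ c.Serving → s c = 0 := fun c h => by
    rw [Config.Serving, not_or] at h
    simp [hs, h.1, h.2]
  have hs2 : ∀ c : Config, c.phase = Phase.two → s c = if j + 1 < k then 1 else 0 := fun c h => by
    simp [hs, h]
  have hs3 : ∀ c : Config, c.phase = Phase.three → s c = if j + 1 ≤ c.numJobs then 1 else 0 :=
    fun c h => by simp [hs, h]
  rw [← green_const_mul, ← green_const_mul, ← hs2 c h2]
  refine (closed_valid hk).green_add_eq ?_ hc ?_
  · intro c hc
    by_cases hsv : c.Serving
    · have hcard := hc.full hsv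
      have hR : c.totalRate lam mu = lam + c.inService.card * mu := rfl
      have hone := ofReal_sum_transition hlam hmu c
      have hu := hc.phase_arrival hk hsv
      have hun := hc.toOrdered.numJobs_arrival (k := k) (ℓ := ℓ)
      rcases hsv with h | h
      -- A completion that ends phase two leaves exactly `k - 1` jobs.
      · have hv : ∀ b ∈ c.inService, s (c.after k ℓ {Sum.inr b}) = s c := by
          intro b hb
          have h3 := hc.phase_completion_two hk h hb
          have h4 := hc.toOrdered.numJobs_completion (k := k) (ℓ := ℓ) hb
          have h5 := hc.two h
          split_ifs at h3
          · rw [hs2 _ h3, hs2 _ h]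
          · rw [hs3 _ h3, hs2 _ h]
            congr 1
            rw [eq_iff_iff]
            omega
        rw [trans_eq hlam hmu (u := s c) (by rw [hs2 _ (hu.trans h), hs2 _ h]) hv, ← add_mul, hone]
        simp [visit, h]
      · have h5 := hc.three h
        -- The completion at `ℓ + 1` ends phase three and makes `s` zero. The formula still holds
        -- there because `ℓ ≤ j` excludes `j + 2 ≤ ℓ + 1`; for `j = ℓ` this exit is the downward
        -- crossing.
        have hv : ∀ b ∈ c.inService, s (c.after k ℓ {Sum.inr b})
            = if j + 2 ≤ c.numJobs then 1 else 0 := by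
          intro b hb
          have h4 := hc.toOrdered.numJobs_completion (k := k) (ℓ := ℓ) hb
          by_cases hn : ℓ + 1 < c.numJobs
          · rw [hs3 _ (Config.phase_completion_three h hn hb)]
            congr 1
            rw [eq_iff_iff]
            omega
          · rw [hs0 _ (Config.not_serving_completion_three h (by omega) hb), if_neg (by omega)]
        rw [trans_eq hlam hmu (u := if j ≤ c.numJobs then 1 else 0)
          (by rw [hs3 _ (hu.trans h), hun]; simp) hv, hs3 c h]
        simp only [visit, h, true_and]
        rcases lt_trichotomy c.numJobs j with hlt | heq | hgt
        · simp only [show ¬ c.numJobs = j + 1 by omega, show ¬ j ≤ c.numJobs by omega,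
            show ¬ j + 2 ≤ c.numJobs by omega, show ¬ c.numJobs = j by omega,
            show ¬ j + 1 ≤ c.numJobs by omega, if_false, mul_zero, add_zero]
        · rw [heq] at hcard
          simp only [heq, show ¬ j = j + 1 by omega, show ¬ j + 2 ≤ j by omega,
            show ¬ j + 1 ≤ j by omega, le_refl, if_true, if_false, mul_zero, mul_one, zero_add,
            add_zero, hR, hcard]
        · rcases (show j + 1 ≤ c.numJobs from hgt).eq_or_lt' with heq | hgt'
          · rw [heq] at hcard
            rw [hR, hcard] at hone
            simp only [heq, show ¬ j + 2 ≤ j + 1 by omega, show ¬ j + 1 = j by omega,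
              show j ≤ j + 1 by omega, le_refl, if_true, if_false, mul_zero, mul_one, zero_add,
              add_zero, hR, hcard]
            rw [add_comm, hone]
          · simp only [show ¬ c.numJobs = j + 1 by omega, show j ≤ c.numJobs by omega,
              show j + 2 ≤ c.numJobs by omega, show ¬ c.numJobs = j by omega,
              show j + 1 ≤ c.numJobs by omega, if_false, if_true, mul_zero, mul_one, hone, zero_add]
    · have h1 : trans k ℓ lam mu s c = 0 := Finset.sum_eq_zero fun e he => by
        rw [hs0 _ (hc.toOrdered.not_serving_after hsv he), mul_zero]
      have h3 : c.phase ≠ Phase.three := fun h => hsv (Or.inr h)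
      rw [h1, hs0 c hsv]
      simp [visit, h3]
  -- The chain ends below every cut, because `s` is dominated by the indicator of phases two and
  -- three, whose potential is finite.
  · refine (closed_valid hk).tendsto_of_le_mul (K := 1) (g := fun c => if c.Serving then 1 else 0)
      ENNReal.one_ne_top (fun c _ => ?_) hc (green_serving_ne_top hk hlam hmu hstable hc)
    by_cases hsv : c.Serving
    · simp only [hs, if_pos hsv, one_mul]
      split_ifs <;> simp
    · rw [hs0 c hsv]
      exact zero_le

lemma green_visit_of_le (hk : ℓ + 1 < k) (hc : c.Valid k ℓ) {j : ℕ} (hj : j ≤ ℓ) :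
    green k ℓ lam mu (visit j) c = 0 := by
  rw [(closed_valid hk).green_congr (g := fun c => 0 * visit j c) _ hc, green_const_mul, zero_mul]
  intro c hc
  rw [zero_mul, visit, if_neg]
  rintro ⟨h, h'⟩
  have := hc.three h
  omega

lemma coeff_of_le {j : ℕ} (hj : j ≤ ℓ) : coeff k ℓ lam mu j = 0 := by
  cases j with
  | zero => rfl
  | succ i => rw [coeff, if_pos (by omega)]

/-- All branches of the recursion are this one relation solved for `C_{j+1}`: the first uses `C_ℓ =
0`, and for `j ≥ k` both rates equal `λ + k μ` and cancel. -/
lemma coeff_cut (hlam : 0 < lam) (hmu : 0 < mu) (hk : ℓ + 1 < k) {j : ℕ} (hj : ℓ ≤ j) :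
    (min k (j + 1) : ℕ) * mu / (lam + (min k (j + 1) : ℕ) * mu) * coeff k ℓ lam mu (j + 1)
      = lam / (lam + (min k j : ℕ) * mu) * coeff k ℓ lam mu j + if j + 1 < k then 1 else 0 := by
  have hkpos : (0 : ℝ) < k := by exact_mod_cast (by omega : 0 < k)
  have hd : 0 < lam + k * mu := by positivity
  rw [coeff]
  rcases hj.eq_or_lt with rfl | hlt
  · rw [coeff_of_le le_rfl, if_neg (lt_irrefl _), if_pos rfl, if_pos (by omega), if_pos (by omega),
      min_eq_right (by omega : ℓ + 1 ≤ k)]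
    push_cast
    have : (0 : ℝ) < lam + (ℓ + 1) * mu := by positivity
    field_simp
    simp
  · rw [if_neg (by omega), if_neg (by omega)]
    split_ifs with h1 h2 h3 h3
    · rw [min_eq_right h1, min_eq_right (by omega : j ≤ k)]
      push_cast
      have : (0 : ℝ) < lam + (j + 1) * mu := by positivity
      have : (0 : ℝ) < lam + j * mu := by positivity
      rw [add_sub_cancel_right]
      field_simp
    · omega
    · omega
    · rw [min_eq_right h1, min_eq_right (by omega : j ≤ k)]
      push_cast
      have : (0 : ℝ) < lam + (j + 1) * mu := by positivity
      have : (0 : ℝ) < lam + j * mu := by positivity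
      rw [add_sub_cancel_right]
      field_simp
    · omega
    · rw [min_eq_left (by omega : k ≤ j + 1), min_eq_left (by omega : k ≤ j)]
      field_simp
      ring

lemma coeff_nonneg (hlam : 0 < lam) (hmu : 0 < mu) (hk : ℓ + 1 < k) (j : ℕ) :
    0 ≤ coeff k ℓ lam mu j := by
  induction j with
  | zero => exact le_rfl
  | succ j ih =>
    by_cases hj : ℓ ≤ j
    · have h := coeff_cut hlam hmu hk hj
      have h1 : 0 < (min k (j + 1) : ℕ) * mu / (lam + (min k (j + 1) : ℕ) * mu) := by
        have : (0 : ℝ) < (min k (j + 1) : ℕ) := by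
          exact_mod_cast (by omega : 0 < min k (j + 1))
        positivity
      have h2 : 0 ≤ lam / (lam + (min k j : ℕ) * mu) * coeff k ℓ lam mu j
          + if j + 1 < k then 1 else 0 := by split_ifs <;> positivity
      rw [← h] at h2
      exact nonneg_of_mul_nonneg_right h2 h1
    · rw [coeff_of_le (by omega)]

/-- The expected number of visits to `j` in phase three. -/
lemma green_visit (hk : ℓ + 1 < k) (hlam : 0 < lam) (hmu : 0 < mu)
    (hstable : lam < k * mu) (hc : c.Valid k ℓ) (h2 : c.phase = Phase.two) (j : ℕ) :
    green k ℓ lam mu (visit j) c = ENNReal.ofReal (coeff k ℓ lam mu j) := by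
  induction j with
  | zero => rw [green_visit_of_le hk hc (Nat.zero_le _), coeff_of_le (Nat.zero_le _),
      ENNReal.ofReal_zero]
  | succ j ih =>
    by_cases hj : ℓ ≤ j
    · have h := green_visit_succ hk hlam hmu hstable hc h2 hj
      have h1 : 0 < (min k (j + 1) : ℕ) * mu / (lam + (min k (j + 1) : ℕ) * mu) := by
        have : (0 : ℝ) < (min k (j + 1) : ℕ) := by
          exact_mod_cast (by omega : 0 < min k (j + 1))
        positivity
      have h3 : (if j + 1 < k then 1 else 0 : ℝ≥0∞)
          = ENNReal.ofReal (if j + 1 < k then 1 else 0) := by split_ifs <;> simp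
      have h4 := coeff_nonneg hlam hmu hk j (k := k) (ℓ := ℓ)
      rw [ih, h3, ← ENNReal.ofReal_mul (by positivity), ← ENNReal.ofReal_add (by positivity)
        (by split_ifs <;> positivity), ← coeff_cut hlam hmu hk hj, ENNReal.ofReal_mul h1.le] at h
      exact (ENNReal.mul_right_inj (by simpa using h1) ENNReal.ofReal_ne_top).1 h
    · rw [green_visit_of_le hk hc (by omega), coeff_of_le (by omega), ENNReal.ofReal_zero]

end Visits

/-! ### Mean response time of a job arriving in phase three -/

section Response

variable {k ℓ : ℕ} {lam mu : ℝ} {c : Config}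

lemma Config.mem_admit_inService {k : ℕ} {c : Config} {i : ℕ} :
    i ∈ (Config.admit k c).inService
      ↔ i ∈ c.inService ∨ (c.started ≤ i ∧ i < (Config.admit k c).started) := by
  unfold Config.admit
  split_ifs
  · simp
  · constructor
    · exact Or.inl
    · rintro (h | h)
      · exact h
      · omega

lemma Config.started_admit (h : c.phase = Phase.two ∨ c.phase = Phase.three) :
    (Config.admit k c).started
      = c.started + min (k - c.inService.card) (c.arrived - c.started) := by
  unfold Config.admit
  rw [if_pos h]

lemma Config.mem_inService_arrival {i : ℕ} :
    i ∈ (c.after k ℓ {Sum.inl c.arrived}).inService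
      ↔ i ∈ c.inService ∨ (c.started ≤ i ∧ i < (c.after k ℓ {Sum.inl c.arrived}).started) := by
  rw [after_arrival, mem_admit_inService]

lemma Config.mem_inService_completion {b i : ℕ} :
    i ∈ (c.after k ℓ {Sum.inr b}).inService
      ↔ (i ≠ b ∧ i ∈ c.inService) ∨ (c.started ≤ i ∧ i < (c.after k ℓ {Sum.inr b}).started) := by
  rw [after_completion, mem_admit_inService, Finset.mem_erase]

lemma Config.Valid.started_arrival (hk : ℓ + 1 < k) (hc : c.Valid k ℓ) (hs : c.Serving) :
    (c.after k ℓ {Sum.inl c.arrived}).started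
      = c.started + min (k - c.inService.card) (c.arrived + 1 - c.started) := by
  have h := hc.phase_arrival hk hs
  rw [after_arrival, admit_phase] at h
  rw [after_arrival, started_admit]
  change nextPhase _ _ _ _ _ = _ ∨ nextPhase _ _ _ _ _ = _
  change nextPhase _ _ _ _ _ = _ at h
  rwa [h]

/-- A nonempty queue means that all `k` servers are busy, so at least `k` jobs remain after the
completion, too many for phase three to end. Hence no waiting job is stranded by phase four. -/
lemma Config.Valid.serving_completion (hk : ℓ + 1 < k) (hc : c.Valid k ℓ) (hs : c.Serving)
    (hw : c.started < c.arrived) {b : ℕ} (hb : b ∈ c.inService) :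
    (c.after k ℓ {Sum.inr b}).Serving := by
  have h1 := hc.full hs
  have h2 : c.numJobs = c.inService.card + (c.arrived - c.started) := rfl
  rcases hs with h | h
  · have := hc.phase_completion_two hk h hb
    split_ifs at this
    · exact Or.inl this
    · exact Or.inr this
  · exact Or.inr (Config.phase_completion_three h (by omega) hb)

lemma Config.Valid.card_of_waiting (hc : c.Valid k ℓ) (hs : c.Serving)
    (hw : c.started < c.arrived) : c.inService.card = k := by
  have h1 := hc.full hs
  have h2 : c.numJobs = c.inService.card + (c.arrived - c.started) := rfl
  omega

lemma Config.Valid.started_completion (hk : ℓ + 1 < k) (hc : c.Valid k ℓ) (hs : c.Serving)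
    (hw : c.started < c.arrived) {b : ℕ} (hb : b ∈ c.inService) :
    (c.after k ℓ {Sum.inr b}).started = c.started + 1 := by
  have h := hc.serving_completion hk hs hw hb
  have h1 := hc.card_of_waiting hs hw
  have h2 := Finset.card_erase_add_one hb
  rw [Serving, after_completion, admit_phase] at h
  rw [after_completion, started_admit h]
  simp only
  omega

/-- The job `i` has arrived, at most `K` jobs are served before it, and it will be served. -/
structure Config.Tracks (k ℓ i K : ℕ) (c : Config) : Prop extends c.Valid k ℓ where
  lt_arrived : i < c.arrived
  le_add : i ≤ c.started + K
  serving : c.started ≤ i → c.Serving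

lemma closed_tracks (hk : ℓ + 1 < k) (i K : ℕ) : Closed k ℓ (Config.Tracks k ℓ i K) := by
  intro c hc e he
  have h1 := Config.started_le_after k ℓ c {e}
  refine ⟨closed_valid hk c hc.toValid e he, ?_, ?_, fun hi => ?_⟩
  · have := hc.lt_arrived
    rw [Config.after_arrived]
    split_ifs <;> omega
  · have := hc.le_add
    omega
  · have hs := hc.serving (h1.trans hi)
    rcases Config.mem_active.1 he with rfl | ⟨b, hb, rfl⟩
    · rw [Config.Serving, hc.phase_arrival hk hs]
      exact hs
    · exact hc.serving_completion hk hs ((h1.trans hi).trans_lt hc.lt_arrived) hb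

open Classical in
/-- The mean residual time in the system of job `i`. -/
noncomputable def residual (k : ℕ) (mu : ℝ) (i : ℕ) (c : Config) : ℝ≥0∞ :=
  if i ∈ c.inService then ENNReal.ofReal (1 / mu)
  else if c.started ≤ i then ENNReal.ofReal (1 / mu + ((i - c.started : ℕ) + 1) / (k * mu)) else 0

open Classical in
/-- The mean time until the next event, counted if job `i` is in the system. -/
noncomputable def holding (lam mu : ℝ) (i : ℕ) (c : Config) : ℝ≥0∞ :=
  if c.InSystem i then ENNReal.ofReal (1 / c.totalRate lam mu) else 0

/-- First-step analysis. A job in service completes at rate `μ` whatever the phase. A job with `w`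
others ahead of it in the queue needs `w + 1` completions at rate `k μ` to enter service; arrivals
do not affect its place. -/
lemma holding_add_trans_residual (hk : ℓ + 1 < k) (hlam : 0 < lam) (hmu : 0 < mu) {i K : ℕ}
    (hc : c.Tracks k ℓ i K) :
    holding lam mu i c + trans k ℓ lam mu (residual k mu i) c = residual k mu i c := by
  classical
  have hR := c.totalRate_pos hlam hmu
  have hR' : c.totalRate lam mu = lam + c.inService.card * mu := rfl
  have hia := hc.lt_arrived
  have hkpos : (0 : ℝ) < k := by exact_mod_cast (by omega : 0 < k)
  by_cases hi : i ∈ c.inService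
  · have hist := hc.lt_started i hi
    have h1 : ∀ e, e ≠ Sum.inr i → e ∈ c.active →
        residual k mu i (c.after k ℓ {e}) = ENNReal.ofReal (1 / mu) := by
      intro e hei he
      rw [residual, if_pos]
      rcases Config.mem_active.1 he with rfl | ⟨b, hb, rfl⟩
      · exact Config.mem_inService_arrival.2 (Or.inl hi)
      · exact Config.mem_inService_completion.2 (Or.inl ⟨by rintro rfl; exact hei rfl, hi⟩)
    have h2 : residual k mu i (c.after k ℓ {Sum.inr i}) = 0 := by
      have := Config.started_le_after k ℓ c {Sum.inr i}
      rw [residual, if_neg, if_neg (by omega)]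
      rw [Config.mem_inService_completion]
      rintro (h | h)
      · exact h.1 rfl
      · omega
    have hmem : Sum.inr i ∈ c.active := Config.mem_active.2 (Or.inr ⟨i, hi, rfl⟩)
    rw [trans, ← Finset.add_sum_erase _ _ hmem, h2, mul_zero, zero_add,
      Finset.sum_congr rfl fun e he => by
        rw [h1 e (Finset.ne_of_mem_erase he) (Finset.mem_of_mem_erase he)], ← Finset.sum_mul,
      holding, if_pos (show c.InSystem i from Or.inl hi), residual, if_pos hi]
    have h3 : ENNReal.ofReal (1 / c.totalRate lam mu)
        = ENNReal.ofReal (rate lam mu (Sum.inr i) / c.totalRate lam mu)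
          * ENNReal.ofReal (1 / mu) := by
      rw [← ENNReal.ofReal_mul (by simp only [rate, Sum.elim_inr]; positivity)]
      simp only [rate, Sum.elim_inr]
      congr 1
      field_simp
    rw [h3, ← add_mul, Finset.add_sum_erase c.active
      (fun e => ENNReal.ofReal (rate lam mu e / c.totalRate lam mu)) hmem,
      sum_transition hlam hmu, one_mul]
  · by_cases hist : c.started ≤ i
    · have hs := hc.serving hist
      have hw : c.started < c.arrived := hist.trans_lt hia
      have hcard := hc.card_of_waiting hs hw
      obtain ⟨w, rfl⟩ := Nat.exists_eq_add_of_le hist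
      have hu : residual k mu (c.started + w) (c.after k ℓ {Sum.inl c.arrived})
          = ENNReal.ofReal (1 / mu + (w + 1) / (k * mu)) := by
        have h1 := hc.started_arrival hk hs
        rw [hcard, Nat.sub_self, Nat.zero_min, add_zero] at h1
        rw [residual, if_neg, h1, if_pos (by omega), Nat.add_sub_cancel_left]
        rw [Config.mem_inService_arrival, h1]
        rintro (h | h)
        · exact hi h
        · omega
      have hv : ∀ b ∈ c.inService, residual k mu (c.started + w) (c.after k ℓ {Sum.inr b})
          = ENNReal.ofReal (1 / mu + w / (k * mu)) := by
        intro b hb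
        have h1 := hc.started_completion hk hs hw hb
        -- With nobody ahead, the completion puts the job itself into service; otherwise it moves up
        -- by one place.
        cases w with
        | zero =>
          rw [residual, if_pos]
          · simp
          · exact Config.mem_inService_completion.2 (Or.inr ⟨by omega, by omega⟩)
        | succ w =>
          rw [residual, if_neg, h1, if_pos (by omega)]
          · have : c.started + (w + 1) - (c.started + 1) = w := by omega
            rw [this]
            push_cast
            rfl
          · rw [Config.mem_inService_completion, h1]
            rintro (h | h)
            · exact hi h.2
            · omega
      rw [trans_eq hlam hmu hu hv, holding,
        if_pos (show c.InSystem (c.started + w) from Or.inr ⟨hist, hia⟩), residual, if_neg hi,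
        if_pos hist, ← ENNReal.ofReal_mul (by positivity),
        ← ENNReal.ofReal_mul (by positivity), ← ENNReal.ofReal_add (by positivity) (by positivity),
        ← ENNReal.ofReal_add (by positivity) (by positivity), Nat.add_sub_cancel_left]
      congr 1
      rw [hR', hcard]
      have : 0 < lam + k * mu := by positivity
      field_simp
      ring
    · have h1 : trans k ℓ lam mu (residual k mu i) c = 0 := by
        refine Finset.sum_eq_zero fun e he => ?_
        have h2 := Config.started_le_after k ℓ c {e}
        rw [residual, if_neg, if_neg (by omega), mul_zero]
        intro h
        rcases Config.mem_after_inService h with h | h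
        · exact hi h.1
        · omega
      have h2 : ¬ c.InSystem i := by
        rintro (h | h)
        · exact hi h
        · exact hist h.1
      rw [h1, holding, if_neg h2, residual, if_neg hi, if_neg hist, zero_add]

/-- The mean response time of a tracked job. -/
lemma green_holding (hk : ℓ + 1 < k) (hlam : 0 < lam) (hmu : 0 < mu) {i K : ℕ}
    (hc : c.Tracks k ℓ i K) :
    green k ℓ lam mu (holding lam mu i) c = residual k mu i c := by
  have hkpos : (0 : ℝ) < k := by exact_mod_cast (by omega : 0 < k)
  -- At most `K` jobs are ahead, so the residual time is at most `1 / μ + (K + 1) / (k μ)`, while a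
  -- holding time has mean at least `1 / (λ + k μ)`; the constant is the quotient of these bounds.
  refine (closed_tracks hk i K).green_eq (fun c hc => holding_add_trans_residual hk hlam hmu hc)
    (K := ENNReal.ofReal ((1 / mu + (K + 1) / (k * mu)) * (lam + k * mu))) ENNReal.ofReal_ne_top
    (fun c hc => ?_) hc ?_
  · have hR := c.totalRate_pos hlam hmu
    by_cases hs : c.InSystem i
    · rw [holding, if_pos hs, ← ENNReal.ofReal_mul (by positivity)]
      have h1 : residual k mu i c ≤ ENNReal.ofReal (1 / mu + (K + 1) / (k * mu)) := by
        unfold residual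
        split_ifs
        · exact ENNReal.ofReal_le_ofReal (le_add_of_nonneg_right (by positivity))
        · refine ENNReal.ofReal_le_ofReal ?_
          have : ((i - c.started : ℕ) : ℝ) ≤ K := by
            have := hc.le_add
            exact_mod_cast (by omega : i - c.started ≤ K)
          gcongr
        · exact zero_le
      refine h1.trans (ENNReal.ofReal_le_ofReal ?_)
      rw [mul_assoc]
      refine le_mul_of_one_le_right (by positivity) ?_
      rw [mul_one_div, one_le_div hR, Config.totalRate]
      have : (c.inService.card : ℝ) ≤ k := by exact_mod_cast hc.card_le
      gcongr
    · have h1 : i ∉ c.inService := fun h => hs (Or.inl h)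
      have h2 : ¬ c.started ≤ i := fun h => hs (Or.inr ⟨h, hc.lt_arrived⟩)
      simp [residual, h1, h2]
  · unfold residual
    split_ifs <;> simp

/-- The mean response time of a job that arrives in phase three. -/
lemma green_holding_arrival (hk : ℓ + 1 < k) (hlam : 0 < lam) (hmu : 0 < mu)
    (hc : c.Valid k ℓ) (h3 : c.phase = Phase.three) :
    green k ℓ lam mu (holding lam mu c.arrived) (c.after k ℓ {Sum.inl c.arrived})
      = ENNReal.ofReal (responseSeeing k mu c.numJobs) := by
  have hkpos : (0 : ℝ) < k := by exact_mod_cast (by omega : 0 < k)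
  have hs : c.Serving := Or.inr h3
  have hact : Sum.inl c.arrived ∈ c.active := Config.mem_active.2 (Or.inl rfl)
  have hst := hc.started_arrival hk hs
  have hle := hc.started_le
  have hfull := hc.full hs
  have hnum : c.numJobs = c.inService.card + (c.arrived - c.started) := rfl
  have htr : (c.after k ℓ {Sum.inl c.arrived}).Tracks k ℓ c.arrived c.arrived :=
    ⟨closed_valid hk c hc _ hact, by rw [Config.after_arrived]; simp, by omega,
      fun _ => by rw [Config.Serving, hc.phase_arrival hk hs]; exact hs⟩
  rw [green_holding hk hlam hmu htr]
  -- With an idle server the job starts at once, and the positive part vanishes. Otherwise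
  -- `c.numJobs - k` jobs are ahead of it in the queue.
  rcases lt_or_ge c.numJobs k with hlt | hge
  · have h1 : (c.after k ℓ {Sum.inl c.arrived}).started = c.arrived + 1 := by omega
    rw [residual, if_pos, responseSeeing, max_eq_right]
    · congr 1
      field_simp
      ring
    · have : ((c.numJobs + 1 : ℕ) : ℝ) ≤ k := by exact_mod_cast hlt
      push_cast at this
      linarith
    · exact Config.mem_inService_arrival.2 (Or.inr ⟨hle, by omega⟩)
  · have h1 : (c.after k ℓ {Sum.inl c.arrived}).started = c.started := by omega
    have h2 : c.arrived - c.started = c.numJobs - k := by omega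
    have h4 : (k : ℝ) ≤ c.numJobs := by exact_mod_cast hge
    rw [residual, if_neg, h1, if_pos hle, responseSeeing, max_eq_left (by linarith), h2,
      Nat.cast_sub hge]
    · congr 1
      field_simp
    · rw [Config.mem_inService_arrival, h1]
      rintro (h | h)
      · have := hc.lt_started _ h
        omega
      · omega

end Response

/-! ### Pathwise sums over jobs as sums over events -/

section Paths

variable {k ℓ : ℕ} {lam mu : ℝ} {c : Config}

lemma Config.Ordered.iterate (hc : c.Ordered) (k ℓ m : ℕ) : ((Config.step k ℓ)^[m] c).Ordered := by
  induction m with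
  | zero => exact hc
  | succ m ih => rw [Function.iterate_succ_apply']; exact ih.step k ℓ

lemma Config.arrived_le_step (k ℓ : ℕ) (c : Config) : c.arrived ≤ (c.step k ℓ).arrived := by
  obtain ⟨x, hx⟩ := c.exists_withClocks
  rw [← hx, step_withClocks, withClocks_arrived, withClocks_arrived, after_arrived]
  split_ifs <;> omega

open Classical in
/-- Summation over the jumps of a nondecreasing sequence, indexed by their starting values or by
their times. -/
lemma tsum_jumps {a : ℕ → ℕ} (ha : Monotone a) (p : ℕ → Prop) (r : ℕ → ℝ≥0∞) :
    ∑' i, (if ∃ m, p m ∧ a m = i ∧ a (m + 1) = i + 1 then r i else 0)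
      = ∑' m, if p m ∧ a (m + 1) = a m + 1 then r (a m) else 0 := by
  have h1 : ∀ i, (if ∃ m, p m ∧ a m = i ∧ a (m + 1) = i + 1 then r i else 0)
      = ∑' m, if p m ∧ a m = i ∧ a (m + 1) = i + 1 then r i else 0 := by
    intro i
    split_ifs with h
    · obtain ⟨m, hm⟩ := h
      -- A monotone sequence jumps from `i` to `i + 1` at most once.
      rw [tsum_eq_single m, if_pos hm]
      intro m' hne
      refine if_neg fun hm' => ?_
      rcases lt_or_gt_of_ne hne with hlt | hlt
      · have := ha (Nat.succ_le_of_lt hlt)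
        simp only [Nat.succ_eq_add_one] at this
        omega
      · have := ha (Nat.succ_le_of_lt hlt)
        simp only [Nat.succ_eq_add_one] at this
        omega
    · rw [ENNReal.tsum_eq_zero.2]
      exact fun m => if_neg fun hm => h ⟨m, hm⟩
  simp_rw [h1]
  rw [ENNReal.tsum_comm]
  refine tsum_congr fun m => ?_
  rw [tsum_eq_single (a m)]
  · simp
  · intro i hi
    exact if_neg fun h => hi h.2.1.symm

open Classical in
/-- The time until the next event, counted if job `i` is in the system. -/
noncomputable def holdingIn (i : ℕ) (c : Config) : ℝ≥0∞ :=
  if c.InSystem i then ENNReal.ofReal c.holdingTime else 0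

/-- The time that job `i` spends in the system from now on. -/
noncomputable def sojourn (k ℓ i : ℕ) (c : Config) : ℝ≥0∞ :=
  ∑' m, holdingIn i ((Config.step k ℓ)^[m] c)

open Classical in
/-- `W i` of the next configuration if the next event is the arrival of job `i` in phase three. -/
noncomputable def arrivalValue (k ℓ : ℕ) (W : ℕ → Config → ℝ≥0∞) (c : Config) : ℝ≥0∞ :=
  if c.phase = Phase.three ∧ (c.step k ℓ).arrived = c.arrived + 1 then W c.arrived (c.step k ℓ)
  else 0

/-- The beginning of phase two with `n` jobs, apart from the residual times. -/
noncomputable def start (k n : ℕ) : Config := initial k n (fun _ => 0) (fun _ => 0)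

lemma initial_eq (k n : ℕ) (X S : ℕ → ℝ) :
    initial k n X S = (start k n).withClocks (Sum.elim X S) := by
  unfold start initial
  rw [← Config.withClocks_admit]
  rfl

lemma start_phase (k n : ℕ) : (start k n).phase = Phase.two := by
  rw [start, initial, Config.admit_phase]

lemma valid_start {n : ℕ} (hn : k ≤ n) : (start k n).Valid k ℓ := by
  have h1 : (start k n).inService.card = min k n := by
    rw [start, initial, Config.card_admit (by simp) (Or.inl rfl)]
    simp
  have h2 : (start k n).numJobs = n := by
    rw [start, initial, Config.numJobs_admit (by simp)]
    simp [Config.numJobs]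
  refine ⟨⟨fun i hi => ?_, ?_⟩, ?_, fun _ => ?_, fun _ => ?_, fun h => ?_⟩
  · rw [start, initial, Config.mem_admit_inService] at hi
    rcases hi with hi | hi
    · simp at hi
    · exact hi.2
  · simp [start, initial, Config.admit]
  · omega
  · rw [h1, h2]
  · omega
  · rw [start_phase] at h
    cases h

lemma monotone_arrived (k ℓ n : ℕ) (X S : ℕ → ℝ) :
    Monotone fun m => (config k ℓ n X S m).arrived := by
  refine monotone_nat_of_le_succ fun m => ?_
  simp only [config, Function.iterate_succ_apply']
  exact Config.arrived_le_step k ℓ _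

lemma numArrivals_eq (k ℓ n : ℕ) (X S : ℕ → ℝ) :
    numArrivals k ℓ n X S
      = ∑' m, arrivalValue k ℓ (fun _ _ => 1) ((Config.step k ℓ)^[m] (initial k n X S)) := by
  classical
  unfold numArrivals ArrivesInPhaseThree
  rw [tsum_jumps (monotone_arrived k ℓ n X S)
    (fun m => (config k ℓ n X S m).phase = Phase.three) (fun _ => 1)]
  refine tsum_congr fun m => ?_
  simp only [arrivalValue, config, Function.iterate_succ_apply']

/-- Up to the `m`-th event every job in the system has a number below the current `arrived`, so the
earlier terms vanish and the response time becomes a functional of the configuration after the next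
event. -/
lemma responseTime_eq {n : ℕ} (hn : k ≤ n) (X S : ℕ → ℝ) (m : ℕ) :
    responseTime k ℓ n X S (config k ℓ n X S m).arrived
      = sojourn k ℓ (config k ℓ n X S m).arrived (config k ℓ n X S (m + 1)) := by
  set i := (config k ℓ n X S m).arrived with hi
  have h0 : (initial k n X S).Ordered := by
    rw [initial_eq, Config.ordered_withClocks]
    exact (valid_start (ℓ := ℓ) hn).toOrdered
  have hinj : Function.Injective fun j : ℕ => j + (m + 1) := add_left_injective _
  have h1 : Function.support (fun j => holdingIn i (config k ℓ n X S j))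
      ⊆ Set.range fun j : ℕ => j + (m + 1) := by
    intro j hj
    by_contra hr
    have hjm : j ≤ m := by
      by_contra h
      exact hr ⟨j - (m + 1), by simp only; omega⟩
    have h2 := monotone_arrived k ℓ n X S hjm
    have h3 := h0.iterate k ℓ j
    refine hj (if_neg ?_)
    rintro (h | h)
    · have h4 := h3.lt_started _ h
      have h5 := h3.started_le
      simp only [config] at h2 hi
      omega
    · simp only [config] at h2 hi h
      omega
  have h2 := hinj.tsum_eq h1
  refine h2.symm.trans (tsum_congr fun j => ?_)
  simp only [config, ← Function.iterate_add_apply]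

lemma totalResponse_eq {n : ℕ} (hn : k ≤ n) (X S : ℕ → ℝ) :
    totalResponse k ℓ n X S
      = ∑' m, arrivalValue k ℓ (sojourn k ℓ) ((Config.step k ℓ)^[m] (initial k n X S)) := by
  classical
  unfold totalResponse ArrivesInPhaseThree
  rw [tsum_jumps (monotone_arrived k ℓ n X S)
    (fun m => (config k ℓ n X S m).phase = Phase.three) (responseTime k ℓ n X S)]
  refine tsum_congr fun m => ?_
  rw [responseTime_eq hn]
  simp only [arrivalValue, config, Function.iterate_succ_apply']

end Paths

/-! ### Means of path sums through the embedded chain -/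

section Means

variable {k ℓ : ℕ} {lam mu : ℝ} {c : Config}

lemma observable_holdingIn (i : ℕ) : Observable (holdingIn i) := by
  classical
  have h : holdingIn i
      = fun c => (if c.InSystem i then 1 else 0) * ENNReal.ofReal c.holdingTime := by
    ext c
    simp [holdingIn]
  rw [h]
  exact (observable_of_withClocks (F := fun c => if c.InSystem i then 1 else 0)
    fun _ _ => rfl).mul observable_holdingTime

lemma observable_sojourn (k ℓ i : ℕ) : Observable (sojourn k ℓ i) :=
  Observable.tsum fun m => (observable_holdingIn i).iterate k ℓ m

lemma observable_visit (j : ℕ) : Observable (visit j) := observable_of_withClocks fun _ _ => rfl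

open Classical in
-- `arrivalValue` looks at the configuration both before and after a step. Freezing the phase and
-- the job number from before leaves a function of the next configuration alone, to which
-- `mean_step` applies.
lemma observable_arrivalValue_aux {W : ℕ → Config → ℝ≥0∞} (hW : ∀ i, Observable (W i)) (p : Phase)
    (i : ℕ) : Observable fun c => (if p = Phase.three ∧ c.arrived = i + 1 then 1 else 0) * W i c :=
  (observable_of_withClocks (F := fun c => if p = Phase.three ∧ c.arrived = i + 1 then 1 else 0)
    fun _ _ => rfl).mul (hW i)

open Classical in
lemma arrivalValue_withClocks (W : ℕ → Config → ℝ≥0∞) (c : Config) (x : Clocks) :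
    arrivalValue k ℓ W (c.withClocks x)
      = (if c.phase = Phase.three ∧ ((c.withClocks x).step k ℓ).arrived = c.arrived + 1
          then 1 else 0) * W c.arrived ((c.withClocks x).step k ℓ) := by
  by_cases h : c.phase = Phase.three ∧ ((c.withClocks x).step k ℓ).arrived = c.arrived + 1
  · rw [if_pos h, one_mul, arrivalValue, if_pos (by exact h)]
    rfl
  · rw [if_neg h, zero_mul, arrivalValue, if_neg (by exact h)]

lemma observable_arrivalValue {W : ℕ → Config → ℝ≥0∞} (hW : ∀ i, Observable (W i)) :
    Observable (arrivalValue k ℓ W) := by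
  classical
  have h := fun c : Config =>
    (observable_arrivalValue_aux hW c.phase c.arrived).comp_step k ℓ
  constructor
  · intro c
    simp_rw [arrivalValue_withClocks]
    exact (h c).measurable c
  · intro c x y hxy
    simp_rw [arrivalValue_withClocks]
    exact (h c).congr c x y hxy

variable (hlam : 0 < lam) (hmu : 0 < mu)
include hlam hmu

lemma mean_tsum_iterate {F : Config → ℝ≥0∞} (hF : Observable F) (hc : c.Ordered) :
    mean lam mu (fun c => ∑' m, F ((Config.step k ℓ)^[m] c)) c
      = green k ℓ lam mu (mean lam mu F) c := by
  unfold mean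
  rw [lintegral_tsum fun m => ((hF.iterate k ℓ m).measurable c).aemeasurable]
  exact tsum_congr fun m => mean_iterate hlam hmu k ℓ m hF hc

omit hlam hmu in
lemma closed_ordered (k ℓ : ℕ) : Closed k ℓ Config.Ordered := fun _ hc _ _ => hc.after k ℓ _

lemma mean_holdingIn (i : ℕ) (hc : c.Ordered) :
    mean lam mu (holdingIn i) c = holding lam mu i c := by
  by_cases h : c.InSystem i
  · rw [holding, if_pos h, ← mean_holdingTime hlam hmu hc]
    exact lintegral_congr fun x => if_pos h
  · rw [holding, if_neg h, ← lintegral_zero]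
    exact lintegral_congr fun x => if_neg h

lemma mean_sojourn (i : ℕ) (hc : c.Ordered) :
    mean lam mu (sojourn k ℓ i) c = green k ℓ lam mu (holding lam mu i) c :=
  (mean_tsum_iterate hlam hmu (observable_holdingIn i) hc).trans
    ((closed_ordered k ℓ).green_congr (fun _ hc => mean_holdingIn hlam hmu i hc) hc)

/-- Of all transitions only the arrival raises `arrived`, so a single term of the transition sum
survives. -/
lemma mean_arrivalValue {W : ℕ → Config → ℝ≥0∞} (hW : ∀ i, Observable (W i)) (hc : c.Ordered) :
    mean lam mu (arrivalValue k ℓ W) c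
      = if c.phase = Phase.three then ENNReal.ofReal (lam / c.totalRate lam mu)
        * mean lam mu (W c.arrived) (c.after k ℓ {Sum.inl c.arrived}) else 0 := by
  classical
  have h1 := mean_step hlam hmu k ℓ (observable_arrivalValue_aux hW c.phase c.arrived) hc
  have h2 : mean lam mu (arrivalValue k ℓ W) c = mean lam mu (fun c' =>
      (if c.phase = Phase.three ∧ (c'.step k ℓ).arrived = c.arrived + 1 then 1 else 0)
        * W c.arrived (c'.step k ℓ)) c :=
    lintegral_congr fun x => arrivalValue_withClocks W c x
  rw [h2, h1]
  split_ifs with h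
  · rw [trans, Config.sum_active, Finset.sum_eq_zero, add_zero]
    · simp [h, mean, rate, Config.after_arrived]
    · intro b _
      simp [mean, Config.after_arrived]
  · refine Finset.sum_eq_zero fun e _ => ?_
    simp [h, mean]

/-- The mean of the total value of the arrivals in phase three. -/
lemma mean_tsum_arrivalValue (hk : ℓ + 1 < k) (hstable : lam < k * mu)
    {W : ℕ → Config → ℝ≥0∞} (hW : ∀ i, Observable (W i)) {w : ℕ → ℝ} (hw : ∀ j, 0 ≤ w j)
    (hWw : ∀ c : Config, c.Valid k ℓ → c.phase = Phase.three →
      mean lam mu (W c.arrived) (c.after k ℓ {Sum.inl c.arrived}) = ENNReal.ofReal (w c.numJobs))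
    (hc : c.Valid k ℓ) (h2 : c.phase = Phase.two) :
    mean lam mu (fun c => ∑' m, arrivalValue k ℓ W ((Config.step k ℓ)^[m] c)) c
      = ∑' j, ENNReal.ofReal (lam * (weight k ℓ lam mu j * w j)) := by
  -- Sorting the events by the number `j` of jobs seen turns the mean of one term into a combination
  -- of the indicators `visit j`, whose potentials are the `C_j`.
  rw [mean_tsum_iterate hlam hmu (observable_arrivalValue hW) hc.toOrdered,
    (closed_valid hk).green_congr (g := fun c => ∑' j,
      ENNReal.ofReal (lam / (lam + (min k j : ℕ) * mu) * w j) * visit j c) _ hc, green_tsum]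
  · refine tsum_congr fun j => ?_
    have := hw j
    rw [green_const_mul, green_visit hk hlam hmu hstable hc h2,
      ← ENNReal.ofReal_mul (by positivity), weight]
    congr 1
    ring
  · intro c hc
    rw [mean_arrivalValue hlam hmu hW hc.toOrdered, tsum_eq_single c.numJobs]
    · split_ifs with h
      · have := c.totalRate_pos hlam hmu
        rw [hWw c hc h, ← ENNReal.ofReal_mul (by positivity), hc.totalRate_eq (Or.inr h)]
        simp [visit, h]
      · simp [visit, h]
    · intro j hj
      simp [visit, hj.symm]

end Means

/-! ### Convergence and positivity of the series -/

section Series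

variable {k ℓ : ℕ} {lam mu : ℝ}

lemma weight_nonneg (hlam : 0 < lam) (hmu : 0 < mu) (hk : ℓ + 1 < k) (j : ℕ) :
    0 ≤ weight k ℓ lam mu j :=
  div_nonneg (coeff_nonneg hlam hmu hk j) (by positivity)

lemma responseSeeing_nonneg (hmu : 0 < mu) (j : ℕ) : 0 ≤ responseSeeing k mu j := by
  unfold responseSeeing
  positivity

/-- From `k` on all servers are busy, so the denominators are constant and the recursion is
geometric. Against the affine growth of `responseSeeing` this gives summability. -/
lemma weight_add (hk : ℓ + 1 < k) (n : ℕ) :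
    weight k ℓ lam mu (n + k) = weight k ℓ lam mu k * (lam / (k * mu)) ^ n := by
  have h : ∀ n, coeff k ℓ lam mu (n + k) = coeff k ℓ lam mu k * (lam / (k * mu)) ^ n := by
    intro n
    induction n with
    | zero => simp
    | succ n ih =>
      have : n + 1 + k = n + k + 1 := by omega
      rw [this, coeff, if_neg (by omega), if_neg (by omega), if_neg (by omega), ih, pow_succ]
      ring
  rw [weight, weight, h, min_eq_left (by omega), min_self]
  ring

lemma summable_weight_mul (hlam : 0 < lam) (hmu : 0 < mu) (hk : ℓ + 1 < k)
    (hstable : lam < k * mu) {w : ℕ → ℝ} {a b : ℝ} (hw : ∀ n : ℕ, w (n + k) = a * n + b) :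
    Summable fun j => weight k ℓ lam mu j * w j := by
  have hr : ‖lam / (k * mu)‖ < 1 := by
    rw [Real.norm_of_nonneg (by positivity), div_lt_one (hlam.trans hstable)]
    exact hstable
  rw [← summable_nat_add_iff k]
  have h1 := (summable_pow_mul_geometric_of_norm_lt_one 1 hr).mul_left (weight k ℓ lam mu k * a)
  have h2 := (summable_pow_mul_geometric_of_norm_lt_one 0 hr).mul_left (weight k ℓ lam mu k * b)
  refine (h1.add h2).congr fun n => ?_
  rw [weight_add hk, hw]
  ring

lemma summable_weight (hlam : 0 < lam) (hmu : 0 < mu) (hk : ℓ + 1 < k) (hstable : lam < k * mu) :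
    Summable (weight k ℓ lam mu) :=
  (summable_weight_mul hlam hmu hk hstable (w := fun _ => 1) (a := 0) (b := 1) (by simp)).congr
    fun j => by simp

lemma summable_weight_mul_responseSeeing (hlam : 0 < lam) (hmu : 0 < mu) (hk : ℓ + 1 < k)
    (hstable : lam < k * mu) :
    Summable fun j => weight k ℓ lam mu j * responseSeeing k mu j := by
  refine summable_weight_mul hlam hmu hk hstable (a := 1 / (k * mu)) (b := (k + 1) / (k * mu))
    fun n => ?_
  rw [responseSeeing, max_eq_left (by push_cast; linarith [n.cast_nonneg (α := ℝ)])]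
  push_cast
  ring

/-- The terms with `j ≤ ℓ` vanish, which reconciles the sum over all states with the sum from `ℓ +
1` on. -/
lemma tsum_ofReal_weight_mul (hlam : 0 < lam) (hmu : 0 < mu) (hk : ℓ + 1 < k) {w : ℕ → ℝ}
    (hw : ∀ j, 0 ≤ w j) (hs : Summable fun j => weight k ℓ lam mu j * w j) :
    ∑' j, ENNReal.ofReal (lam * (weight k ℓ lam mu j * w j))
      = ENNReal.ofReal (lam * ∑' i, weight k ℓ lam mu (ℓ + 1 + i) * w (ℓ + 1 + i)) := by
  have h0 := fun j => mul_nonneg (weight_nonneg hlam hmu hk j) (hw j)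
  rw [← ENNReal.ofReal_tsum_of_nonneg (fun j => mul_nonneg hlam.le (h0 j)) (hs.mul_left lam),
    tsum_mul_left]
  congr 2
  have hinj : Function.Injective fun i : ℕ => ℓ + 1 + i := add_right_injective _
  refine (hinj.tsum_eq (f := fun j => weight k ℓ lam mu j * w j) fun j hj => ?_).symm
  by_contra hr
  have hjl : j ≤ ℓ := by
    by_contra h
    exact hr ⟨j - (ℓ + 1), by simp only; omega⟩
  refine hj ?_
  simp only [weight, coeff_of_le hjl, zero_div, zero_mul]

lemma tsum_weight_pos (hlam : 0 < lam) (hmu : 0 < mu) (hk : ℓ + 1 < k) (hstable : lam < k * mu) :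
    0 < ∑' i, weight k ℓ lam mu (ℓ + 1 + i) := by
  have hs := (summable_weight hlam hmu hk hstable).comp_injective (add_right_injective (ℓ + 1))
  refine hs.tsum_pos (fun i => weight_nonneg hlam hmu hk _) 0 ?_
  have h := coeff_cut hlam hmu hk (le_refl ℓ)
  rw [coeff_of_le le_rfl, mul_zero, zero_add, if_pos hk] at h
  have h1 : 0 < coeff k ℓ lam mu (ℓ + 1) := by
    refine (coeff_nonneg hlam hmu hk _).lt_of_ne fun h0 => ?_
    rw [← h0, mul_zero] at h
    exact zero_ne_one h
  exact div_pos h1 (by positivity)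

end Series

/-! ### The joint law of the data and the initial number of jobs -/

section Law

variable {Ω : Type*} [MeasurableSpace Ω]

lemma measurable_sumElim :
    Measurable fun p : (ℕ → ℝ) × (ℕ → ℝ) => (Sum.elim p.1 p.2 : Clocks) := by
  refine measurable_pi_lambda _ fun e => ?_
  rcases e with i | i
  · exact (measurable_pi_apply i).comp measurable_fst
  · exact (measurable_pi_apply i).comp measurable_snd

/-- Independence within and between the two families gives a product of two infinite products; it is
identified with one infinite product over the sum type on boxes, whose finite index sets split into
a left and a right part. -/
lemma map_sumElim {P : Measure Ω} [IsProbabilityMeasure P] {lam mu : ℝ} (hlam : 0 < lam)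
    (hmu : 0 < mu) {X S : ℕ → Ω → ℝ} (hX : ∀ i, Measurable (X i)) (hS : ∀ i, Measurable (S i))
    (hXlaw : ∀ i, P.map (X i) = expMeasure lam) (hSlaw : ∀ i, P.map (S i) = expMeasure mu)
    (hXindep : iIndepFun X P) (hSindep : iIndepFun S P)
    (hXS : IndepFun (fun ω i => X i ω) (fun ω i => S i ω) P) :
    P.map (fun ω => (Sum.elim (fun i => X i ω) (fun i => S i ω) : Clocks)) = clockLaw lam mu := by
  have := isProbabilityMeasure_expMeasure hlam
  have := isProbabilityMeasure_expMeasure hmu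
  have hXm : Measurable fun ω i => X i ω := measurable_pi_lambda _ hX
  have hSm : Measurable fun ω i => S i ω := measurable_pi_lambda _ hS
  have h1 := hXindep.map_fun_eq_infinitePi_map hX
  have h2 := hSindep.map_fun_eq_infinitePi_map hS
  have h3 := (indepFun_iff_map_prod_eq_prod_map_map hXm.aemeasurable hSm.aemeasurable).1 hXS
  simp only [hXlaw] at h1
  simp only [hSlaw] at h2
  rw [h1, h2] at h3
  have h4 := Measure.map_map measurable_sumElim (hXm.prodMk hSm) (μ := P)
  rw [h3] at h4
  refine h4.symm.trans ?_
  have := fun e => isProbabilityMeasure_expMeasure (rate_pos hlam hmu e)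
  refine Measure.eq_infinitePi _ fun s T hT => ?_
  rw [Measure.map_apply measurable_sumElim (.pi s.countable_toSet fun e _ => hT e)]
  have h5 : (fun p : (ℕ → ℝ) × (ℕ → ℝ) => (Sum.elim p.1 p.2 : Clocks)) ⁻¹' ((s : Set _).pi T)
      = (s.toLeft : Set ℕ).pi (fun i => T (Sum.inl i))
        ×ˢ (s.toRight : Set ℕ).pi (fun i => T (Sum.inr i)) := by
    ext p
    simp [Set.mem_pi]
  rw [h5, Measure.prod_prod, Measure.infinitePi_pi _ fun i _ => hT _,
    Measure.infinitePi_pi _ fun i _ => hT _]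
  conv_rhs => rw [← s.toLeft_disjSum_toRight, Finset.prod_disjSum]
  rfl

/-- By independence `N` can be integrated last, and the inner mean is the same `K` for each `n ≥ k`,
so the distribution of `N` drops out. -/
lemma lintegral_initial {P : Measure Ω} [IsProbabilityMeasure P] {k : ℕ} {lam mu : ℝ}
    (hlam : 0 < lam) (hmu : 0 < mu) {N : Ω → ℕ} {X S : ℕ → Ω → ℝ} (hN : Measurable N)
    (hX : ∀ i, Measurable (X i)) (hS : ∀ i, Measurable (S i)) (hNk : ∀ᵐ ω ∂P, k ≤ N ω)
    (hXlaw : ∀ i, P.map (X i) = expMeasure lam) (hSlaw : ∀ i, P.map (S i) = expMeasure mu)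
    (hXindep : iIndepFun X P) (hSindep : iIndepFun S P)
    (hXS : IndepFun (fun ω i => X i ω) (fun ω i => S i ω) P)
    (hNXS : IndepFun N (fun ω => ((fun i => X i ω), (fun i => S i ω))) P)
    {F : Config → ℝ≥0∞} (hF : Observable F) {K : ℝ≥0∞}
    (hK : ∀ n, k ≤ n → mean lam mu F (start k n) = K) :
    ∫⁻ ω, F (initial k (N ω) (fun i => X i ω) (fun i => S i ω)) ∂P = K := by
  have := isProbabilityMeasure_clockLaw hlam hmu
  have hXm : Measurable fun ω i => X i ω := measurable_pi_lambda _ hX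
  have hSm : Measurable fun ω i => S i ω := measurable_pi_lambda _ hS
  have hZ : Measurable fun ω => (Sum.elim (fun i => X i ω) (fun i => S i ω) : Clocks) :=
    measurable_sumElim.comp (hXm.prodMk hSm)
  have hind : IndepFun N (fun ω => (Sum.elim (fun i => X i ω) (fun i => S i ω) : Clocks)) P :=
    hNXS.comp measurable_id measurable_sumElim
  have hmap := (indepFun_iff_map_prod_eq_prod_map_map hN.aemeasurable hZ.aemeasurable).1 hind
  rw [map_sumElim hlam hmu hX hS hXlaw hSlaw hXindep hSindep hXS] at hmap
  have hΦ : Measurable fun p : ℕ × Clocks => F ((start k p.1).withClocks p.2) :=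
    measurable_from_prod_countable_right fun n => hF.measurable (start k n)
  simp_rw [initial_eq]
  have h1 := lintegral_map hΦ (hN.prodMk hZ) (μ := P)
  have := Measure.isProbabilityMeasure_map hN.aemeasurable (μ := P)
  rw [hmap, lintegral_prod _ hΦ.aemeasurable] at h1
  rw [← h1, lintegral_map (f := fun n => ∫⁻ x, F ((start k n).withClocks x) ∂clockLaw lam mu)
    (measurable_of_countable _) hN, lintegral_congr_ae (g := fun _ => K)]
  · simp
  · filter_upwards [hNk] with ω hω using hK _ hω

end Law

end MSFQ

theorem mainTheorem6
    {Ω : Type*} [MeasurableSpace Ω] (P : Measure Ω) [IsProbabilityMeasure P]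
    (k ℓ : ℕ) (hℓ : ℓ + 1 < k)
    (lam mu : ℝ) (hlam : 0 < lam) (hmu : 0 < mu) (hstable : lam < k * mu)
    -- number of small jobs at the beginning of phase 2, interarrival times, service durations
    (N : Ω → ℕ) (X S : ℕ → Ω → ℝ)
    (hN : Measurable N) (hX : ∀ i, Measurable (X i)) (hS : ∀ i, Measurable (S i))
    (hNk : ∀ᵐ ω ∂P, k ≤ N ω)
    (hXlaw : ∀ i, P.map (X i) = expMeasure lam)
    (hSlaw : ∀ i, P.map (S i) = expMeasure mu)
    (hXindep : iIndepFun X P) (hSindep : iIndepFun S P)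
    (hXS : IndepFun (fun ω i => X i ω) (fun ω i => S i ω) P)
    (hNXS : IndepFun N (fun ω => ((fun i => X i ω), (fun i => S i ω))) P) :
    (∀ j, ℓ + 1 ≤ j →
      MSFQ.meanVisits k ℓ P N X S j = ENNReal.ofReal (MSFQ.coeff k ℓ lam mu j)) ∧
    0 < MSFQ.meanArrivals k ℓ P N X S ∧ MSFQ.meanArrivals k ℓ P N X S < ⊤ ∧
    Summable (fun i : ℕ =>
      MSFQ.weight k ℓ lam mu (ℓ + 1 + i) * MSFQ.responseSeeing k mu (ℓ + 1 + i)) ∧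
    Summable (fun i : ℕ => MSFQ.weight k ℓ lam mu (ℓ + 1 + i)) ∧
    0 < ∑' i : ℕ, MSFQ.weight k ℓ lam mu (ℓ + 1 + i) ∧
    MSFQ.meanResponse k ℓ P N X S = ENNReal.ofReal
      ((∑' i : ℕ,
          MSFQ.weight k ℓ lam mu (ℓ + 1 + i) * MSFQ.responseSeeing k mu (ℓ + 1 + i)) /
        ∑' i : ℕ, MSFQ.weight k ℓ lam mu (ℓ + 1 + i)) := by
  have hint := fun {F : MSFQ.Config → ℝ≥0∞} (hF : MSFQ.Observable F) {K : ℝ≥0∞} =>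
    MSFQ.lintegral_initial (K := K) hlam hmu hN hX hS hNk hXlaw hSlaw hXindep hSindep hXS hNXS hF
  have hsw := MSFQ.summable_weight hlam hmu hℓ hstable
  have hswr := MSFQ.summable_weight_mul_responseSeeing hlam hmu hℓ hstable
  have hpos := MSFQ.tsum_weight_pos hlam hmu hℓ hstable
  have hval := fun {n : ℕ} (hn : k ≤ n) => MSFQ.valid_start (ℓ := ℓ) hn
  have hone : MSFQ.Observable fun _ => 1 := MSFQ.observable_of_withClocks fun _ _ => rfl
  have hA : MSFQ.meanArrivals k ℓ P N X S
      = ENNReal.ofReal (lam * ∑' i, MSFQ.weight k ℓ lam mu (ℓ + 1 + i)) := by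
    simp only [MSFQ.meanArrivals, MSFQ.numArrivals_eq]
    refine hint (.tsum fun m => (MSFQ.observable_arrivalValue fun _ => hone).iterate k ℓ m)
      fun n hn => ?_
    rw [MSFQ.mean_tsum_arrivalValue hlam hmu hℓ hstable (fun _ => hone) (w := fun _ => 1)
      (fun _ => zero_le_one) _ (hval hn) (MSFQ.start_phase k n),
      MSFQ.tsum_ofReal_weight_mul hlam hmu hℓ (w := fun _ => 1) (fun _ => zero_le_one)
        (by simpa using hsw)]
    · simp only [mul_one]
    · intro c _ _
      rw [MSFQ.mean_of_withClocks hlam hmu fun _ _ => rfl, ENNReal.ofReal_one]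
  have hT : ∫⁻ ω, MSFQ.totalResponse k ℓ (N ω) (fun i => X i ω) (fun i => S i ω) ∂P
      = ENNReal.ofReal (lam * ∑' i, MSFQ.weight k ℓ lam mu (ℓ + 1 + i)
        * MSFQ.responseSeeing k mu (ℓ + 1 + i)) := by
    -- The pathwise identity is available only where `k ≤ N ω`, hence almost everywhere.
    rw [lintegral_congr_ae (hNk.mono fun ω hω => MSFQ.totalResponse_eq hω _ _)]
    refine hint (.tsum fun m =>
      (MSFQ.observable_arrivalValue (MSFQ.observable_sojourn k ℓ)).iterate k ℓ m) fun n hn => ?_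
    rw [MSFQ.mean_tsum_arrivalValue hlam hmu hℓ hstable (MSFQ.observable_sojourn k ℓ)
      (MSFQ.responseSeeing_nonneg hmu) _ (hval hn) (MSFQ.start_phase k n),
      MSFQ.tsum_ofReal_weight_mul hlam hmu hℓ (MSFQ.responseSeeing_nonneg hmu) hswr]
    intro c hc h3
    rw [MSFQ.mean_sojourn hlam hmu _ (hc.toOrdered.after k ℓ _),
      MSFQ.green_holding_arrival hℓ hlam hmu hc h3]
  refine ⟨fun j _ => ?_, ?_, ?_, hswr.comp_injective (add_right_injective _),
    hsw.comp_injective (add_right_injective _), hpos, ?_⟩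
  · refine hint (.tsum fun m => (MSFQ.observable_visit j).iterate k ℓ m) fun n hn => ?_
    rw [MSFQ.mean_tsum_iterate hlam hmu (MSFQ.observable_visit j) (hval hn).toOrdered,
      ← MSFQ.green_visit hℓ hlam hmu hstable (hval hn) (MSFQ.start_phase k n)]
    congr 1
    ext c
    exact MSFQ.mean_of_withClocks hlam hmu (fun _ _ => rfl) c
  · rw [hA, ENNReal.ofReal_pos]
    positivity
  · rw [hA]
    exact ENNReal.ofReal_lt_top
  -- Both means carry the factor `λ` from the arrival probability, which cancels in the quotient.
  · rw [MSFQ.meanResponse, hT, hA, ← ENNReal.ofReal_div_of_pos (by positivity),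
      mul_div_mul_left _ _ hlam.ne']
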